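/- Let $P$ be a probability measure on a measurable space $\Omega$; write $\langle f|g\rangle=\int fg\,dP$ and $\|f\|=\langle f|f\rangle^{1/2}$ on $L_2(P)$. A tangent is a function $g\in L_2(P)$ with $\int g\,dP=0$. Put $s_n=1/\sqrt n$. For the tangents $g$ considered below let $(P_{n,g})_{n}$ be a sequence of probability measures with $dP_{n,g}\approx(1+s_ng)\,dP$, in the sense that $\sqrt{dP_{n,g}}=(1+\tfrac12 s_ng)\sqrt{dP}+o(s_n)$ in $L_2$ as $n\to\infty$. A test sequence is a sequence $\delta=(\delta_n)$ of measurable functions $\delta_n:\Omega^n\to[0,1]$. For sets $G_0,G_1$ of tangents and $\alpha\in(0,1)$, the maxmin asymptotic testing problem $H_{G_0}$ vs. $K_{G_1}$ at level $\alpha$ is to maximize $\inf_{g_1\in G_1}\liminf_n\int\delta_n\,dP_{n,g_1}^n$ over all test sequences with $\sup_{g_0\in G_0}\limsup_n\int\delta_n\,dP_{n,g_0}^n\le\alpha$; for singletons $G_0=\{g_0\}$, $G_1=\{g_1\}$ this is the simple problem $H_{g_0}$ vs. $K_{g_1}$. A pair in $G_0\times G_1$ is least favorable if the maximal asymptotic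 power of its simple problem is smallest among all pairs in $G_0\times G_1$. A saddle point is a pair $(q_0,q_1)\in G_0\times G_1$ together with a test sequence that is optimal for $H_{q_0}$ vs. $K_{q_1}$, whose asymptotic size over $G_0$ is largest at $q_0$ and whose asymptotic power over $G_1$ is smallest at $q_1$. Let $\Phi$ be the standard normal distribution function and $u_\alpha$ be given by $\Phi(-u_\alpha)=\alpha$. For a pair $g=(g_0,g_1)$ with $g_{10}=g_1-g_0$ let $$\delta_{n,g}=\mathbf 1\Bigl(s_n\sum_{i=1}^n g_{10}(x_i)>\|g_{10}\|u_\alpha+\langle g_{10}|g_0\rangle\Bigr).$$ Let $\Lambda$ be a tangent, $\tau>0$, $r_0,r_1\ge0$, $r=r_0+r_1$, and consider the Hellinger tangent ball $G_h=\{g\in L_2(P):\int g\,dP=0,\ \int g^2\,dP\le 8\}$ and the sets $G_{h,0}=r_0G_h$, $G_{h,1}=\tau\Lambda+r_1G_h$. **Theorem (Hellinger balls).** Let $8r^2<\tau^2\|\Lambda\|^2$. Then: 1. There is a least favorable tangent pair in $G_{h,0}\times G_{h,1}$, it is unique up to $P$-almost sure equality, and it is $q_h=(q_{h,0},q_{h,1})$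 with $$q_{h,0}=r_0\gamma\Lambda,\qquad q_{h,1}=\tau\Lambda-r_1\gamma\Lambda,\qquad \gamma=\sqrt8\,\|\Lambda\|^{-1}.$$ It is also the unique pair in $G_{h,0}\times G_{h,1}$ that minimizes $\|g_1-g_0\|$, and $(q_h,\delta_{q_h})$ is a saddle point of the problem $H_{G_{h,0}}$ vs. $K_{G_{h,1}}$ at level $\alpha$. 2. The test sequence $\delta_{q_h}=(\delta_{n,q_h})$ solves the maxmin problem $H_{G_{h,0}}$ vs. $K_{G_{h,1}}$ at level $\alpha$; it is $$\delta_{n,q_h}=\mathbf 1\Bigl(s_n\|\Lambda\|^{-1}\sum_{i=1}^n\Lambda(x_i)>u_\alpha+\sqrt8\,r_0\Bigr),$$ and every other solution $(\delta_n)$ satisfies $\delta_n-\delta_{n,q_h}\to0$ in $P^n$-probability. 3. The maxmin asymptotic power is $\Phi\bigl(-u_\alpha+\tau\|\Lambda\|-\sqrt8\,r\bigr)$. -/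

import Mathlib

open MeasureTheory ProbabilityTheory Filter Topology
open scoped Pointwise

noncomputable section

namespace AsymptoticTesting

variable {Ω : Type*} [MeasurableSpace Ω]

/-- The standard normal distribution function `Φ`. -/
def stdNormalCDF (t : ℝ) : ℝ := cdf (gaussianReal 0 1) t

/-- The inner product `⟨f|g⟩ = ∫ f g dP`. -/
def l2Inner (P : Measure Ω) (f g : Ω → ℝ) : ℝ := ∫ x, f x * g x ∂P

/-- The norm `‖f‖ = (∫ f² dP)^{1/2}`. -/
def l2Norm (P : Measure Ω) (f : Ω → ℝ) : ℝ := √(∫ x, f x ^ 2 ∂P)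

/-- Tangents at `P`: measurable functions `g ∈ L₂(P)` with `∫ g dP = 0`. -/
structure IsTangent (P : Measure Ω) (g : Ω → ℝ) : Prop where
  measurable : Measurable g
  memLp : MemLp g 2 P
  integral_eq_zero : ∫ x, g x ∂P = 0

/-- The scale `s_n = 1 / √n`. -/
def scale (n : ℕ) : ℝ := 1 / √(n : ℝ)

/-- `dP_{n,g} ≈ (1 + s_n g) dP`, in the Hellinger (`L₂`) sense
`√(dP_{n,g}) = (1 + s_n g / 2) √(dP) + o(s_n)`.  The square roots of densities are taken with
respect to the dominating measure `P + P_{n,g}`; the integral does not depend on this choice. -/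
def IsLocalAlternative (P : Measure Ω) (Q : ℕ → ProbabilityMeasure Ω) (g : Ω → ℝ) : Prop :=
  Tendsto
    (fun n : ℕ => (n : ℝ) *
      ∫ x, (√((Q n : Measure Ω).rnDeriv (P + (Q n : Measure Ω)) x).toReal
        - (1 + scale n / 2 * g x) * √(P.rnDeriv (P + (Q n : Measure Ω)) x).toReal) ^ 2
          ∂(P + (Q n : Measure Ω)))
    atTop (𝓝 0)

/-- A sequence of (possibly randomized) tests, `δ n` being based on `n` observations. -/
def IsTest (δ : (n : ℕ) → (Fin n → Ω) → ℝ) : Prop :=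
  ∀ n, Measurable (δ n) ∧ ∀ x, 0 ≤ δ n x ∧ δ n x ≤ 1

/-- The rejection probability `∫ δ_n dP_{n,g}^n`, where `Q n g` stands for `P_{n,g}`. -/
def rejectProb (Q : ℕ → (Ω → ℝ) → ProbabilityMeasure Ω) (δ : (n : ℕ) → (Fin n → Ω) → ℝ)
    (g : Ω → ℝ) (n : ℕ) : ℝ :=
  ∫ x, δ n x ∂(Measure.pi fun _ : Fin n => (Q n g : Measure Ω))

/-- Asymptotic size under `g`: `limsup_n ∫ δ_n dP_{n,g}^n`. -/
def asySize (Q : ℕ → (Ω → ℝ) → ProbabilityMeasure Ω) (δ : (n : ℕ) → (Fin n → Ω) → ℝ)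
    (g : Ω → ℝ) : ℝ := limsup (rejectProb Q δ g) atTop

/-- Asymptotic power under `g`: `liminf_n ∫ δ_n dP_{n,g}^n`. -/
def asyPower (Q : ℕ → (Ω → ℝ) → ProbabilityMeasure Ω) (δ : (n : ℕ) → (Fin n → Ω) → ℝ)
    (g : Ω → ℝ) : ℝ := liminf (rejectProb Q δ g) atTop

/-- Test sequences that satisfy the constraint of the composite problem,
`sup_{g₀ ∈ G₀} limsup_n ∫ δ_n dP_{n,g₀}^n ≤ α`. -/
def IsLevelTest (Q : ℕ → (Ω → ℝ) → ProbabilityMeasure Ω) (α : ℝ) (G₀ : Set (Ω → ℝ))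
    (δ : (n : ℕ) → (Fin n → Ω) → ℝ) : Prop :=
  IsTest δ ∧ ∀ g₀ ∈ G₀, asySize Q δ g₀ ≤ α

/-- The objective of the composite problem, `inf_{g₁ ∈ G₁} liminf_n ∫ δ_n dP_{n,g₁}^n`. -/
def minPower (Q : ℕ → (Ω → ℝ) → ProbabilityMeasure Ω) (G₁ : Set (Ω → ℝ))
    (δ : (n : ℕ) → (Fin n → Ω) → ℝ) : ℝ := ⨅ g₁ : G₁, asyPower Q δ g₁

/-- Solutions of the maxmin asymptotic testing problem `H_{G₀}` vs. `K_{G₁}` at level `α`. -/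
def IsMaxminTest (Q : ℕ → (Ω → ℝ) → ProbabilityMeasure Ω) (α : ℝ) (G₀ G₁ : Set (Ω → ℝ))
    (δ : (n : ℕ) → (Fin n → Ω) → ℝ) : Prop :=
  IsLevelTest Q α G₀ δ ∧ ∀ δ', IsLevelTest Q α G₀ δ' → minPower Q G₁ δ' ≤ minPower Q G₁ δ

/-- `β` is the maxmin asymptotic power, that is, the attained maximal value of the problem. -/
def IsMaxminPower (Q : ℕ → (Ω → ℝ) → ProbabilityMeasure Ω) (α : ℝ) (G₀ G₁ : Set (Ω → ℝ))
    (β : ℝ) : Prop :=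
  IsGreatest {b | ∃ δ, IsLevelTest Q α G₀ δ ∧ minPower Q G₁ δ = b} β

/-- The maximal asymptotic power in the simple problem `H_{g₀}` vs. `K_{g₁}` at level `α`. -/
def simplePower (Q : ℕ → (Ω → ℝ) → ProbabilityMeasure Ω) (α : ℝ) (g₀ g₁ : Ω → ℝ) : ℝ :=
  sSup {b | ∃ δ, IsLevelTest Q α {g₀} δ ∧ asyPower Q δ g₁ = b}

/-- A least favorable tangent pair: a pair in `G₀ × G₁` for which the simple testing problem has
the smallest maximal asymptotic power. -/
def IsLeastFavorable (Q : ℕ → (Ω → ℝ) → ProbabilityMeasure Ω) (α : ℝ) (G₀ G₁ : Set (Ω → ℝ))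
    (q₀ q₁ : Ω → ℝ) : Prop :=
  q₀ ∈ G₀ ∧ q₁ ∈ G₁ ∧ ∀ g₀ ∈ G₀, ∀ g₁ ∈ G₁, simplePower Q α q₀ q₁ ≤ simplePower Q α g₀ g₁

/-- A pair in `G₀ × G₁` whose difference has minimum norm in `G₁ - G₀`. -/
def IsMinNormPair (P : Measure Ω) (G₀ G₁ : Set (Ω → ℝ)) (q₀ q₁ : Ω → ℝ) : Prop :=
  q₀ ∈ G₀ ∧ q₁ ∈ G₁ ∧ ∀ g₀ ∈ G₀, ∀ g₁ ∈ G₁, l2Norm P (q₁ - q₀) ≤ l2Norm P (g₁ - g₀)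

/-- Saddle points `((q₀, q₁), δ)` of the testing problem `H_{G₀}` vs. `K_{G₁}` at level `α`: the
test `δ` is optimal for `H_{q₀}` vs. `K_{q₁}`, while its size over `G₀` is largest at `q₀` and its
power over `G₁` is smallest at `q₁`. -/
structure IsSaddlePoint (Q : ℕ → (Ω → ℝ) → ProbabilityMeasure Ω) (α : ℝ) (G₀ G₁ : Set (Ω → ℝ))
    (q₀ q₁ : Ω → ℝ) (δ : (n : ℕ) → (Fin n → Ω) → ℝ) : Prop where
  mem_null : q₀ ∈ G₀
  mem_alt : q₁ ∈ G₁
  level : IsLevelTest Q α {q₀} δ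
  size_le : ∀ g₀ ∈ G₀, asySize Q δ g₀ ≤ asySize Q δ q₀
  power_max : ∀ δ', IsLevelTest Q α {q₀} δ' → asyPower Q δ' q₁ ≤ asyPower Q δ q₁
  power_le : ∀ g₁ ∈ G₁, asyPower Q δ q₁ ≤ asyPower Q δ g₁

/-- The asymptotically optimal test `δ_g` of `H_{g₀}` vs. `K_{g₁}`, `u` being the normal upper
`α`-point: with `g₁₀ = g₁ - g₀`, it rejects when
`s_n ∑ᵢ g₁₀(xᵢ) > ‖g₁₀‖ u + ⟨g₁₀|g₀⟩`. -/
def pairTest (P : Measure Ω) (u : ℝ) (g₀ g₁ : Ω → ℝ) (n : ℕ) : (Fin n → Ω) → ℝ :=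
  Set.indicator
    {x | scale n * ∑ i, (g₁ - g₀) (x i) > l2Norm P (g₁ - g₀) * u + l2Inner P (g₁ - g₀) g₀} 1

/-- The Hellinger tangent ball `G_h`: tangents `g` with `∫ g² dP ≤ 8`. -/
def hellingerTangents (P : Measure Ω) : Set (Ω → ℝ) :=
  {g | IsTangent P g ∧ ∫ x, g x ^ 2 ∂P ≤ 8}

/-- `G_{h,0} = r₀ G_h`. -/
def hellingerNull (P : Measure Ω) (r₀ : ℝ) : Set (Ω → ℝ) := r₀ • hellingerTangents P

/-- `G_{h,1} = τ Λ + r₁ G_h`. -/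
def hellingerAlt (P : Measure Ω) (Λ : Ω → ℝ) (τ r₁ : ℝ) : Set (Ω → ℝ) :=
  {τ • Λ} + r₁ • hellingerTangents P

end AsymptoticTesting

end

open AsymptoticTesting

/-! Under local alternatives with tangent `g`, the sum `s_n ∑ h(xᵢ)` is asymptotically `N(⟨h|g⟩,
‖h‖²)` (`tendsto_pi_real_lt_sum`). Hence the pair test of `g₀` against `g₁` has asymptotic size `α`
and power `Φ(-u + ‖g₁ - g₀‖)`, and least favorable means closest in `L₂`. The distance problem is
solved by Cauchy–Schwarz against `Λ`: on the null ball `⟨Λ|·⟩` is largest at `q₀`, on the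
alternative ball it is smallest at `q₁`. This gives `‖g₁ - g₀‖ ≥ N = τ‖Λ‖ - √8 r > 0` with equality
only at `q` (`le_l2Norm_sub`, `ae_eq_of_l2Norm_sub_le`). Since `q₁ - q₀` is a positive multiple of
`Λ`, the same two bounds show that the size of the test is largest at `q₀` and its power smallest at
`q₁`.

An upper bound for the power of arbitrary tests is needed at the pair `q` only, because every other
pair is bounded from below by its own pair test. Both `q₀` and `q₁` are multiples of `Λ`, so no
expansion of likelihoods is required. By the Hellinger bound for products, rejection probabilities
do not change asymptotically when `P_{n,aΛ}` is replaced by any measures whose root densities have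
the same first order expansion (`tendsto_integral_pi_sub_of_isLocalAlternative`). The replacement is
the exponential family generated by `s_n Λ` over a truncation of `P`. There the likelihood ratio of
the products is exactly `c exp((b - a) S_n)` with `S_n = s_n ∑ Λ(xᵢ)`, and the Neyman–Pearson lemma
is an identity (`IsExpTilt.neymanPearson`). Nonnegativity of its left side gives optimality. If the
deficit tends to zero, the test must agree asymptotically with `1(S_n > k)`, and contiguity carries
this uniqueness over to `P^n`. -/

namespace AsymptoticTesting

/-! ### The scale `s_n`. -/

section Scale

lemma scale_nonneg (n : ℕ) : 0 ≤ scale n := by unfold scale; positivity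

lemma natCast_mul_scale_sq {n : ℕ} (hn : n ≠ 0) : (n : ℝ) * scale n ^ 2 = 1 := by
  have : (n : ℝ) ≠ 0 := by exact_mod_cast hn
  rw [scale, div_pow, Real.sq_sqrt (Nat.cast_nonneg n), one_pow, mul_one_div_cancel this]

lemma natCast_mul_scale (n : ℕ) : (n : ℝ) * scale n = √n := by
  rw [scale, mul_one_div, Real.div_sqrt]

lemma natCast_mul_scale_sq_le (n : ℕ) : (n : ℝ) * scale n ^ 2 ≤ 1 := by
  rcases eq_or_ne n 0 with rfl | hn
  · simp
  · exact (natCast_mul_scale_sq hn).le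

lemma tendsto_scale : Tendsto scale atTop (𝓝 0) := by
  have : scale = fun n : ℕ => (√(n : ℝ))⁻¹ := by ext n; simp [scale]
  rw [this]
  exact tendsto_inv_atTop_zero.comp (Real.tendsto_sqrt_atTop.comp tendsto_natCast_atTop_atTop)

end Scale

/-! ### Cauchy–Schwarz. -/

section SquareIntegrable

variable {α : Type*} [MeasurableSpace α] {μ : Measure α}

lemma integral_abs_mul_abs_le {f g : α → ℝ} (hf : MemLp f 2 μ) (hg : MemLp g 2 μ) :
    ∫ x, |f x| * |g x| ∂μ ≤ √(∫ x, f x ^ 2 ∂μ) * √(∫ x, g x ^ 2 ∂μ) := by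
  have h := integral_mul_norm_le_Lp_mul_Lq (μ := μ) (f := f) (g := g) Real.HolderConjugate.two_two
    (by simpa using hf) (by simpa using hg)
  simpa [Real.sqrt_eq_rpow] using h

lemma integrable_abs_mul_abs {f g : α → ℝ} (hf : MemLp f 2 μ) (hg : MemLp g 2 μ) :
    Integrable (fun x => |f x| * |g x|) μ :=
  hf.norm.integrable_mul hg.norm

end SquareIntegrable

/-! ### Real densities and their square roots. -/

section Density

variable {α : Type*} [MeasurableSpace α] {μ P : Measure α} {p : α → ℝ}

/-- `P` has the nonnegative measurable density `p` with respect to `μ`. -/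
structure HasDensity (P μ : Measure α) (p : α → ℝ) : Prop where
  measurable : Measurable p
  nonneg : ∀ x, 0 ≤ p x
  eq_withDensity : P = μ.withDensity fun x => ENNReal.ofReal (p x)

lemma HasDensity.integral_eq {E : Type*} [NormedAddCommGroup E] [NormedSpace ℝ E]
    (h : HasDensity P μ p) (f : α → E) : ∫ x, f x ∂P = ∫ x, p x • f x ∂μ := by
  rw [h.eq_withDensity, integral_withDensity_eq_integral_toReal_smul
    h.measurable.ennreal_ofReal (ae_of_all _ fun x => ENNReal.ofReal_lt_top)]
  simp_rw [ENNReal.toReal_ofReal (h.nonneg _)]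

lemma HasDensity.integrable_iff {E : Type*} [NormedAddCommGroup E] [NormedSpace ℝ E]
    (h : HasDensity P μ p) {f : α → E} :
    Integrable f P ↔ Integrable (fun x => p x • f x) μ := by
  conv_lhs => rw [h.eq_withDensity]
  rw [integrable_withDensity_iff_integrable_smul'
    h.measurable.ennreal_ofReal (ae_of_all _ fun x => ENNReal.ofReal_lt_top)]
  simp_rw [ENNReal.toReal_ofReal (h.nonneg _)]

lemma HasDensity.integrable [IsFiniteMeasure P] (h : HasDensity P μ p) : Integrable p μ := by
  simpa using h.integrable_iff.1 (integrable_const (1 : ℝ))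

lemma HasDensity.integral_density [IsProbabilityMeasure P] (h : HasDensity P μ p) :
    ∫ x, p x ∂μ = 1 := by
  simpa using (h.integral_eq (fun _ => (1 : ℝ))).symm

lemma HasDensity.memLp_mul_sqrt (h : HasDensity P μ p) {f : α → ℝ} (hfm : Measurable f)
    (hf : MemLp f 2 P) : MemLp (fun x => f x * √(p x)) 2 μ := by
  refine (memLp_two_iff_integrable_sq (hfm.mul h.measurable.sqrt).aestronglyMeasurable).2 ?_
  have := h.integrable_iff.1 hf.integrable_sq
  refine this.congr (ae_of_all _ fun x => ?_)
  change p x • f x ^ 2 = (f x * √(p x)) ^ 2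
  rw [smul_eq_mul, mul_pow, Real.sq_sqrt (h.nonneg x), mul_comm]

lemma HasDensity.memLp_sqrt [IsFiniteMeasure P] (h : HasDensity P μ p) :
    MemLp (fun x => √(p x)) 2 μ := by
  simpa using h.memLp_mul_sqrt (f := fun _ => 1) measurable_const (memLp_const 1)

lemma HasDensity.integral_sq_mul_sqrt (h : HasDensity P μ p) (f : α → ℝ) :
    ∫ x, (f x * √(p x)) ^ 2 ∂μ = ∫ x, f x ^ 2 ∂P := by
  rw [h.integral_eq]
  simp only [smul_eq_mul, mul_pow, Real.sq_sqrt (h.nonneg _), mul_comm]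

lemma hasDensity_rnDeriv (P μ : Measure α) [IsFiniteMeasure P] [IsFiniteMeasure μ] (h : P ≪ μ) :
    HasDensity P μ fun x => (P.rnDeriv μ x).toReal where
  measurable := (Measure.measurable_rnDeriv _ _).ennreal_toReal
  nonneg _ := ENNReal.toReal_nonneg
  eq_withDensity := by
    conv_lhs => rw [← Measure.withDensity_rnDeriv_eq P μ h]
    refine withDensity_congr_ae ?_
    filter_upwards [P.rnDeriv_lt_top μ] with x hx
    rw [ENNReal.ofReal_toReal hx.ne]

end Density

/-! ### Second order expansion of characteristic functions under local alternatives. -/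

section CharFun

variable {Ω : Type*} [MeasurableSpace Ω] {P : Measure Ω}

/-- With `r = √q - w√p` one has `q - w²p = r² + 2 r w√p`. The cross term falls to Cauchy–Schwarz
once `|E| |w|` is dominated by `k`. In the application `k` is of order `s_n` and the norm of `r` is
`o(s_n)`, so the bound survives multiplication by `n`. -/
lemma norm_integral_sub_integral_sq_le {Q μ : Measure Ω} [IsProbabilityMeasure Q] {p q w k : Ω → ℝ}
    (hp : HasDensity P μ p) (hq : HasDensity Q μ q) (hwm : Measurable w) (hw : MemLp w 2 P)
    (hkm : Measurable k) (hk : MemLp k 2 P) {E : Ω → ℂ} (hE : Measurable E) (hE2 : ∀ x, ‖E x‖ ≤ 2)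
    (hEk : ∀ x, ‖E x‖ * |w x| ≤ k x) :
    ‖(∫ x, E x ∂Q) - ∫ x, (w x ^ 2 : ℝ) * E x ∂P‖ ≤
      2 * (∫ x, (√(q x) - w x * √(p x)) ^ 2 ∂μ)
        + 2 * (√(∫ x, k x ^ 2 ∂P) * √(∫ x, (√(q x) - w x * √(p x)) ^ 2 ∂μ)) := by
  set r : Ω → ℝ := fun x => √(q x) - w x * √(p x) with hr
  have hrL : MemLp r 2 μ := hq.memLp_sqrt.sub (hp.memLp_mul_sqrt hwm hw)
  have hkL := hp.memLp_mul_sqrt hkm hk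
  have hE' : Integrable E Q :=
    Integrable.of_bound hE.aestronglyMeasurable 2 (ae_of_all _ hE2)
  have hwE : Integrable (fun x => ((w x ^ 2 : ℝ) : ℂ) * E x) P :=
    hw.integrable_sq.ofReal.mul_bdd (c := 2) hE.aestronglyMeasurable (ae_of_all _ hE2)
  rw [hq.integral_eq, hp.integral_eq,
    ← integral_sub (hq.integrable_iff.1 hE') (hp.integrable_iff.1 hwE)]
  refine (norm_integral_le_integral_norm _).trans ?_
  rw [← hp.integral_sq_mul_sqrt k]
  refine le_trans ?_ (add_le_add_right (mul_le_mul_of_nonneg_left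
    (integral_abs_mul_abs_le hkL hrL) zero_le_two) _)
  rw [← integral_const_mul, ← integral_const_mul, ← integral_add
    (hrL.integrable_sq.const_mul 2) ((integrable_abs_mul_abs hkL hrL).const_mul 2)]
  refine integral_mono_of_nonneg (ae_of_all _ fun x => norm_nonneg _)
    ((hrL.integrable_sq.const_mul 2).add ((integrable_abs_mul_abs hkL hrL).const_mul 2))
    (ae_of_all _ fun x => ?_)
  have h1 : q x • E x - p x • (((w x ^ 2 : ℝ) : ℂ) * E x)
      = ((r x ^ 2 + 2 * r x * (w x * √(p x)) : ℝ) : ℂ) * E x := by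
    have : r x ^ 2 + 2 * r x * (w x * √(p x)) = q x - w x ^ 2 * p x := by
      simp only [hr]
      linear_combination Real.sq_sqrt (hq.nonneg x) - w x ^ 2 * Real.sq_sqrt (hp.nonneg x)
    rw [this, Complex.real_smul, Complex.real_smul]
    push_cast; ring
  have hk0 : 0 ≤ k x := (mul_nonneg (norm_nonneg _) (abs_nonneg _)).trans (hEk x)
  simp only [h1, norm_mul, Complex.norm_real, Real.norm_eq_abs]
  have h2 : |r x ^ 2 + 2 * r x * (w x * √(p x))| ≤ r x ^ 2 + 2 * |r x| * (|w x| * √(p x)) := by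
    refine (abs_add_le _ _).trans (le_of_eq ?_)
    simp [abs_mul, abs_of_nonneg (Real.sqrt_nonneg (p x))]
  have h3 : |k x * √(p x)| = k x * √(p x) := abs_of_nonneg (by positivity)
  calc _ ≤ (r x ^ 2 + 2 * |r x| * (|w x| * √(p x))) * ‖E x‖ := by gcongr
    _ = r x ^ 2 * ‖E x‖ + 2 * |r x| * √(p x) * (‖E x‖ * |w x|) := by ring
    _ ≤ r x ^ 2 * 2 + 2 * |r x| * √(p x) * k x := by
        gcongr
        · exact hE2 x
        · exact hEk x
    _ = _ := by rw [h3]; ring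

variable [IsProbabilityMeasure P]

lemma norm_cexp_mul_I_sub_one_le (x : ℝ) : ‖Complex.exp (x * Complex.I) - 1‖ ≤ |x| := by
  rw [mul_comm]; exact Real.norm_exp_I_mul_ofReal_sub_one_le

lemma norm_cexp_mul_I_sub_one_le_two (x : ℝ) : ‖Complex.exp (x * Complex.I) - 1‖ ≤ 2 := by
  refine (norm_sub_le _ _).trans ?_
  rw [Complex.norm_exp_ofReal_mul_I]; norm_num

lemma norm_cexp_mul_I_sub_one_sub_le (x : ℝ) :
    ‖Complex.exp (x * Complex.I) - 1 - x * Complex.I‖ ≤ 3 * x ^ 2 := by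
  have hn : ‖(x * Complex.I : ℂ)‖ = |x| := by simp
  rcases le_or_gt |x| 1 with h | h
  · refine (Complex.norm_exp_sub_one_sub_id_le (by rwa [hn])).trans ?_
    rw [hn, sq_abs]; nlinarith [sq_nonneg x]
  · refine (norm_sub_le _ _).trans ?_
    rw [hn]
    have := norm_cexp_mul_I_sub_one_le_two x
    have h2 : 1 ≤ x ^ 2 := by rw [← sq_abs]; nlinarith
    have h3 : |x| ≤ x ^ 2 := by rw [← sq_abs]; nlinarith
    linarith

lemma tendsto_natCast_mul_cexp_sub (y : ℝ) :
    Tendsto (fun n : ℕ => (n : ℂ) * (Complex.exp ((scale n * y : ℝ) * Complex.I) - 1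
      - (scale n * y : ℝ) * Complex.I)) atTop (𝓝 (-(y ^ 2 / 2 : ℝ))) := by
  have hs : Tendsto (fun n => scale n * |y| ^ 3) atTop (𝓝 0) := by
    simpa using tendsto_scale.mul_const (|y| ^ 3)
  have hs' : Tendsto (fun n => scale n * |y|) atTop (𝓝 0) := by
    simpa using tendsto_scale.mul_const |y|
  rw [tendsto_iff_norm_sub_tendsto_zero]
  refine squeeze_zero' (Eventually.of_forall fun n => norm_nonneg _) ?_ hs
  filter_upwards [hs'.eventually_le_const one_pos, eventually_ne_atTop 0] with n hn hn0
  have hz : ‖((scale n * y : ℝ) * Complex.I : ℂ)‖ = scale n * |y| := by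
    simp [abs_of_nonneg (scale_nonneg n)]
  have hb := Complex.exp_bound (x := (scale n * y : ℝ) * Complex.I) (by rw [hz]; exact hn)
    (n := 3) (by norm_num)
  rw [hz] at hb
  have e : (n : ℂ) * (Complex.exp ((scale n * y : ℝ) * Complex.I) - 1
      - (scale n * y : ℝ) * Complex.I) - (-(y ^ 2 / 2 : ℝ))
      = n * (Complex.exp ((scale n * y : ℝ) * Complex.I) -
        ∑ m ∈ Finset.range 3, ((scale n * y : ℝ) * Complex.I : ℂ) ^ m / (m.factorial : ℂ)) := by
    have h1 : ((n : ℝ) * scale n ^ 2 : ℂ) = 1 := by exact_mod_cast natCast_mul_scale_sq hn0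
    simp only [Finset.sum_range_succ, Finset.sum_range_zero, Nat.factorial]
    push_cast at h1 ⊢
    linear_combination (-(y : ℂ) ^ 2 / 2) * h1
      + (n : ℂ) * (scale n) ^ 2 * y ^ 2 / 2 * Complex.I_sq
  rw [e, norm_mul, Complex.norm_natCast]
  calc (n : ℝ) * _ ≤ n * ((scale n * |y|) ^ 3 *
        ((Nat.succ 3 : ℝ) * ((Nat.factorial 3 : ℝ) * (3 : ℕ))⁻¹)) := by gcongr
    _ ≤ n * ((scale n * |y|) ^ 3 * 1) := by
        have := scale_nonneg n
        gcongr
        norm_num [Nat.factorial]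
    _ = (n * scale n ^ 2) * (scale n * |y| ^ 3) := by ring
    _ = _ := by rw [natCast_mul_scale_sq hn0, one_mul]

/-- Expanding the square as `1 + s_n g + s_n² g²/4` leaves three terms. The first yields the
variance, the second the mean shift `⟨h|g⟩`, the third vanishes; dominated convergence applies since
`n s_n² ≤ 1`. -/
lemma tendsto_integral_sq_mul_cexp {g h : Ω → ℝ} (hgm : Measurable g) (hhm : Measurable h)
    (hg : MemLp g 2 P) (hh : MemLp h 2 P) (h0 : ∫ x, h x ∂P = 0) (t : ℝ) :
    Tendsto (fun n : ℕ => (n : ℂ) * ∫ x, (((1 + scale n / 2 * g x) ^ 2 : ℝ) : ℂ) *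
      (Complex.exp ((t * (scale n * h x) : ℝ) * Complex.I) - 1) ∂P) atTop
      (𝓝 (t * l2Inner P h g * Complex.I - l2Norm P h ^ 2 * t ^ 2 / 2)) := by
  set F : ℕ → Ω → ℂ := fun n x =>
    (n : ℂ) * (Complex.exp ((scale n * (t * h x) : ℝ) * Complex.I) - 1
      - (scale n * (t * h x) : ℝ) * Complex.I)
    + (n * scale n : ℝ) * g x * (Complex.exp ((scale n * (t * h x) : ℝ) * Complex.I) - 1)
    + (n * scale n ^ 2 : ℝ) / 4 * g x ^ 2 *
      (Complex.exp ((scale n * (t * h x) : ℝ) * Complex.I) - 1) with hF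
  have hgh : Integrable (fun x => h x * g x) P := hh.integrable_mul hg
  have hbound : Integrable (fun x => 3 * (t ^ 2 * h x ^ 2) + |t| * (|h x| * |g x|) + g x ^ 2) P :=
    (((hh.integrable_sq.const_mul _).const_mul _).add
      ((integrable_abs_mul_abs hh hg).const_mul _)).add hg.integrable_sq
  have hlim : Tendsto (fun n => ∫ x, F n x ∂P) atTop
      (𝓝 (∫ x, (-((t * h x) ^ 2 / 2 : ℝ) + (t * h x * g x : ℝ) * Complex.I + 0 : ℂ) ∂P)) := by
    refine tendsto_integral_filter_of_dominated_convergence _ ?_ ?_ hbound ?_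
    · refine Eventually.of_forall fun n => Measurable.aestronglyMeasurable ?_
      simp only [hF]; fun_prop
    · refine Eventually.of_forall fun n => ae_of_all _ fun x => ?_
      have hs := scale_nonneg n
      have hb := natCast_mul_scale_sq_le n
      have e1 := norm_cexp_mul_I_sub_one_sub_le (scale n * (t * h x))
      have e2 := norm_cexp_mul_I_sub_one_le (scale n * (t * h x))
      have e3 := norm_cexp_mul_I_sub_one_le_two (scale n * (t * h x))
      refine (norm_add₃_le).trans ?_
      refine add_le_add (add_le_add ?_ ?_) ?_
      · rw [norm_mul, Complex.norm_natCast]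
        calc _ ≤ (n : ℝ) * (3 * (scale n * (t * h x)) ^ 2) := by gcongr
          _ = (n * scale n ^ 2) * (3 * (t ^ 2 * h x ^ 2)) := by ring
          _ ≤ 1 * (3 * (t ^ 2 * h x ^ 2)) := by gcongr
          _ = _ := one_mul _
      · rw [norm_mul, norm_mul, Complex.norm_real, Complex.norm_real, Real.norm_eq_abs,
          Real.norm_eq_abs, abs_of_nonneg (show (0:ℝ) ≤ n * scale n by positivity)]
        calc _ ≤ n * scale n * |g x| * |scale n * (t * h x)| := by gcongr
          _ = (n * scale n ^ 2) * (|t| * (|h x| * |g x|)) := by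
              rw [abs_mul, abs_mul, abs_of_nonneg hs]; ring
          _ ≤ 1 * (|t| * (|h x| * |g x|)) := by gcongr
          _ = _ := one_mul _
      · have : ‖((n * scale n ^ 2 : ℝ) / 4 * g x ^ 2 : ℂ)‖ = (n * scale n ^ 2) / 4 * g x ^ 2 := by
          have : ((n * scale n ^ 2 : ℝ) / 4 * g x ^ 2 : ℂ)
            = (((n * scale n ^ 2) / 4 * g x ^ 2 : ℝ) : ℂ) := by push_cast; ring
          rw [this, Complex.norm_real, Real.norm_of_nonneg (by positivity)]
        rw [norm_mul, this]
        calc _ ≤ (n * scale n ^ 2) / 4 * g x ^ 2 * 2 := by gcongr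
          _ ≤ 1 / 4 * g x ^ 2 * 2 := by gcongr
          _ ≤ g x ^ 2 := by nlinarith [sq_nonneg (g x)]
    · refine ae_of_all _ fun x => ?_
      have hc : Tendsto (fun n => Complex.exp ((scale n * (t * h x) : ℝ) * Complex.I) - 1)
          atTop (𝓝 0) := by
        have : Tendsto (fun n => Complex.exp ((scale n * (t * h x) : ℝ) * Complex.I) - 1) atTop
            (𝓝 (Complex.exp (((0 * (t * h x) : ℝ) : ℂ) * Complex.I) - 1)) := by
          have hcont : Continuous fun s : ℝ => Complex.exp ((s * (t * h x) : ℝ) * Complex.I) - 1 := by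
            fun_prop
          exact (hcont.tendsto 0).comp tendsto_scale
        simpa using this
      have h1 := tendsto_natCast_mul_cexp_sub (t * h x)
      refine (h1.add ?_).add ?_
      -- The second order remainder, multiplied by `n`, stays bounded, so the extra factor `s_n`
      -- removes it and only the linear term remains.
      · have h2 : Tendsto (fun n : ℕ => (g x : ℂ) * ((scale n : ℂ) *
            ((n : ℂ) * (Complex.exp ((scale n * (t * h x) : ℝ) * Complex.I) - 1
            - (scale n * (t * h x) : ℝ) * Complex.I)) + (t * h x : ℝ) * Complex.I)) atTop
            (𝓝 (g x * (0 * (-((t * h x) ^ 2 / 2 : ℝ)) + (t * h x : ℝ) * Complex.I))) := by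
          refine Tendsto.const_mul _ (Tendsto.add_const _ (Tendsto.mul ?_ h1))
          exact_mod_cast (Complex.continuous_ofReal.tendsto 0).comp tendsto_scale
        have e : ((t * h x * g x : ℝ) * Complex.I : ℂ)
            = g x * (0 * (-((t * h x) ^ 2 / 2 : ℝ)) + (t * h x : ℝ) * Complex.I) := by
          push_cast; ring
        rw [e]
        refine h2.congr' ?_
        filter_upwards [eventually_ne_atTop 0] with n hn
        have h1 : ((n : ℝ) * scale n ^ 2 : ℂ) = 1 := by exact_mod_cast natCast_mul_scale_sq hn
        push_cast at h1 ⊢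
        linear_combination (-(g x * t * h x * Complex.I : ℂ)) * h1
      · have h2 : Tendsto (fun n : ℕ => ((g x : ℂ) ^ 2 / 4) *
            (Complex.exp ((scale n * (t * h x) : ℝ) * Complex.I) - 1)) atTop (𝓝 0) := by
          simpa using hc.const_mul ((g x : ℂ) ^ 2 / 4)
        refine h2.congr' ?_
        filter_upwards [eventually_ne_atTop 0] with n hn
        rw [natCast_mul_scale_sq hn]; push_cast; ring
  have hL : ∫ x, (-((t * h x) ^ 2 / 2 : ℝ) + (t * h x * g x : ℝ) * Complex.I + 0 : ℂ) ∂P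
      = t * l2Inner P h g * Complex.I - l2Norm P h ^ 2 * t ^ 2 / 2 := by
    have i1 : Integrable (fun x => (t * h x) ^ 2 / 2) P := by
      simp_rw [mul_pow]; exact (hh.integrable_sq.const_mul _).div_const _
    have i2 : Integrable (fun x => t * h x * g x) P := by
      simp_rw [mul_assoc]; exact hgh.const_mul _
    have j1 : Integrable (fun x => (-((t * h x) ^ 2 / 2 : ℝ) : ℂ)) P := i1.ofReal.neg
    have j2 : Integrable (fun x => ((t * h x * g x : ℝ) * Complex.I : ℂ)) P :=
      i2.ofReal.mul_const _
    simp only [add_zero]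
    rw [integral_add j1 j2, integral_neg, integral_mul_const, integral_complex_ofReal, integral_complex_ofReal]
    have e1 : ∫ x, (t * h x) ^ 2 / 2 ∂P = t ^ 2 * l2Norm P h ^ 2 / 2 := by
      rw [l2Norm, Real.sq_sqrt (integral_nonneg fun x => sq_nonneg _), integral_div]
      simp_rw [mul_pow]; rw [integral_const_mul]
    have e2 : ∫ x, t * h x * g x ∂P = t * l2Inner P h g := by
      simp_rw [mul_assoc]; rw [integral_const_mul, l2Inner]
    rw [e1, e2]; push_cast; ring
  rw [hL] at hlim
  refine hlim.congr fun n => ?_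
  have ih : Integrable (fun x => (((scale n * (t * h x) : ℝ) : ℂ) * Complex.I)) P :=
    ((((hh.integrable one_le_two).const_mul _).const_mul _).ofReal).mul_const _
  have i3 : Integrable (fun x => (((1 + scale n / 2 * g x) ^ 2 : ℝ) : ℂ) *
      (Complex.exp ((t * (scale n * h x) : ℝ) * Complex.I) - 1)) P := by
    refine Integrable.mul_bdd (c := 2) ?_ (Measurable.aestronglyMeasurable (by fun_prop))
      (ae_of_all _ fun x => norm_cexp_mul_I_sub_one_le_two _)
    exact (((memLp_const (1 : ℝ)).add (hg.const_mul (scale n / 2))).integrable_sq).ofReal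
  -- Since `h` is centered, the linear term, which would be of order `n s_n = √n`, can be subtracted
  -- at no cost.
  have hz : ∫ x, (((scale n * (t * h x) : ℝ) : ℂ) * Complex.I) ∂P = 0 := by
    rw [integral_mul_const, integral_complex_ofReal, integral_const_mul, integral_const_mul, h0]; simp
  rw [← sub_zero (∫ x, (((1 + scale n / 2 * g x) ^ 2 : ℝ) : ℂ) * _ ∂P), ← hz,
    ← integral_sub i3 ih, ← integral_const_mul]
  refine integral_congr_ae (ae_of_all _ fun x => ?_)
  have : t * (scale n * h x) = scale n * (t * h x) := by ring
  simp only [hF, this]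
  push_cast
  ring

lemma tendsto_natCast_mul_integral_cexp_sub_one {Q : ℕ → ProbabilityMeasure Ω} {g h : Ω → ℝ}
    (hgm : Measurable g) (hhm : Measurable h) (hg : MemLp g 2 P) (hh : MemLp h 2 P)
    (h0 : ∫ x, h x ∂P = 0) (hQ : IsLocalAlternative P Q g) (t : ℝ) :
    Tendsto (fun n : ℕ => (n : ℂ) * ∫ x,
      (Complex.exp ((t * (scale n * h x) : ℝ) * Complex.I) - 1) ∂(Q n : Measure Ω)) atTop
      (𝓝 (t * l2Inner P h g * Complex.I - l2Norm P h ^ 2 * t ^ 2 / 2)) := by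
  refine tendsto_of_tendsto_of_dist (tendsto_integral_sq_mul_cexp hgm hhm hg hh h0 t) ?_
  -- In the product of `E` and `1 + s_n g / 2`, the bound `|E| ≤ s_n |t h|` is used against `1` and
  -- the bound `|E| ≤ 2` against `s_n g / 2`; together they give `s_n K`.
  set K : Ω → ℝ := fun x => |t| * |h x| + |g x| with hK
  have hKL : MemLp K 2 P := (hh.abs.const_mul _).add hg.abs
  set R : ℕ → ℝ := fun n => ∫ x, (√((Q n : Measure Ω).rnDeriv (P + (Q n : Measure Ω)) x).toReal
        - (1 + scale n / 2 * g x) * √(P.rnDeriv (P + (Q n : Measure Ω)) x).toReal) ^ 2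
          ∂(P + (Q n : Measure Ω)) with hR
  have hlim : Tendsto (fun n : ℕ => 2 * (n * R n) + 2 * (√(∫ x, K x ^ 2 ∂P) * √(n * R n)))
      atTop (𝓝 0) := by
    have h1 : Tendsto (fun n : ℕ => n * R n) atTop (𝓝 0) := hQ
    have h2 : Tendsto (fun n : ℕ => √(n * R n)) atTop (𝓝 0) := by
      simpa using h1.sqrt
    simpa using (h1.const_mul 2).add ((h2.const_mul (√(∫ x, K x ^ 2 ∂P))).const_mul 2)
  refine squeeze_zero (fun n => dist_nonneg) (fun n => ?_) hlim
  have hp := hasDensity_rnDeriv P (P + (Q n : Measure Ω)) (Measure.le_add_right le_rfl).absolutelyContinuous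
  have hq := hasDensity_rnDeriv (Q n : Measure Ω) (P + (Q n : Measure Ω))
    (Measure.le_add_left le_rfl).absolutelyContinuous
  have hs := scale_nonneg n
  have key := norm_integral_sub_integral_sq_le (w := fun x => 1 + scale n / 2 * g x)
    (k := fun x => scale n * K x)
    (E := fun x => Complex.exp ((t * (scale n * h x) : ℝ) * Complex.I) - 1) hp hq
    (by fun_prop) ((memLp_const (1 : ℝ)).add (hg.const_mul (scale n / 2)))
    (by fun_prop) (hKL.const_mul _) (by fun_prop)
    (fun x => norm_cexp_mul_I_sub_one_le_two _) (fun x => by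
      have e2 := norm_cexp_mul_I_sub_one_le (t * (scale n * h x))
      have e3 := norm_cexp_mul_I_sub_one_le_two (t * (scale n * h x))
      have e4 : |1 + scale n / 2 * g x| ≤ 1 + scale n / 2 * |g x| := by
        refine (abs_add_le _ _).trans (le_of_eq ?_)
        rw [abs_one, abs_mul, abs_of_nonneg (by positivity : 0 ≤ scale n / 2)]
      have e5 : |t * (scale n * h x)| = scale n * (|t| * |h x|) := by
        rw [abs_mul, abs_mul, abs_of_nonneg hs]; ring
      calc _ ≤ ‖Complex.exp ((t * (scale n * h x) : ℝ) * Complex.I) - 1‖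
            * (1 + scale n / 2 * |g x|) := by gcongr
        _ = ‖Complex.exp ((t * (scale n * h x) : ℝ) * Complex.I) - 1‖
          + ‖Complex.exp ((t * (scale n * h x) : ℝ) * Complex.I) - 1‖ * (scale n / 2 * |g x|) := by
            ring
        _ ≤ |t * (scale n * h x)| + 2 * (scale n / 2 * |g x|) := by gcongr
        _ = scale n * K x := by rw [e5, hK]; ring)
  rw [dist_eq_norm', ← mul_sub, norm_mul, Complex.norm_natCast]
  refine (mul_le_mul_of_nonneg_left key (Nat.cast_nonneg n)).trans (le_of_eq ?_)
  have e : √(∫ x, (scale n * K x) ^ 2 ∂P) = scale n * √(∫ x, K x ^ 2 ∂P) := by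
    simp_rw [mul_pow]
    rw [integral_const_mul, Real.sqrt_mul (sq_nonneg _), Real.sqrt_sq hs]
  rw [e, Real.sqrt_mul (Nat.cast_nonneg n), ← natCast_mul_scale]
  ring

end CharFun

/-! ### The standard normal distribution function. -/

section Normal

/-- Lebesgue measure is absolutely continuous with respect to the Gaussian, so no nondegenerate
interval is a Gaussian null set. -/
lemma strictMono_stdNormalCDF : StrictMono stdNormalCDF := by
  intro a b hab
  rw [stdNormalCDF, stdNormalCDF, cdf_eq_real, cdf_eq_real, ← Set.Iic_union_Ioc_eq_Iic hab.le,
    measureReal_union (Set.Iic_disjoint_Ioc le_rfl) measurableSet_Ioc]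
  refine lt_add_of_pos_right _ (ENNReal.toReal_pos (fun h0 => ?_) (measure_ne_top _ _))
  have := gaussianReal_absolutelyContinuous' 0 one_ne_zero h0
  rw [Real.volume_Ioc, ENNReal.ofReal_eq_zero] at this
  linarith

lemma stdNormalCDF_pos (t : ℝ) : 0 < stdNormalCDF t :=
  (cdf_nonneg _ _).trans_lt (strictMono_stdNormalCDF (sub_one_lt t))

lemma stdNormalCDF_lt_one (t : ℝ) : stdNormalCDF t < 1 :=
  (strictMono_stdNormalCDF (lt_add_one t)).trans_le (cdf_le_one _ _)

lemma continuous_stdNormalCDF : Continuous stdNormalCDF := by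
  rw [continuous_iff_continuousAt]
  intro t
  have := nullSingletonClass_gaussianReal (μ := 0) one_ne_zero
  have h := (cdf (gaussianReal 0 1)).measure_singleton t
  rw [measure_cdf, measure_singleton, eq_comm, ENNReal.ofReal_eq_zero, sub_nonpos] at h
  have hm := monotone_cdf (gaussianReal 0 1)
  refine hm.continuousAt_iff_leftLim_eq_rightLim.2 ?_
  rw [StieltjesFunction.rightLim_eq]
  exact le_antisymm (hm.leftLim_le le_rfl) h

lemma tendsto_stdNormalCDF_atTop : Tendsto stdNormalCDF atTop (𝓝 1) :=
  tendsto_cdf_atTop _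

lemma tendsto_stdNormalCDF_atBot : Tendsto stdNormalCDF atBot (𝓝 0) :=
  tendsto_cdf_atBot _

/-- The normal law is written as that of `m - σZ` rather than `m + σZ`, which turns an upper tail
directly into a value of `Φ`. -/
lemma gaussianReal_real_Ioi (m k : ℝ) {σ : ℝ} (hσ : 0 < σ) :
    (gaussianReal m (NNReal.mk (σ ^ 2) (sq_nonneg σ))).real (Set.Ioi k) = stdNormalCDF ((m - k) / σ) := by
  have := nullSingletonClass_gaussianReal (μ := 0) one_ne_zero
  have hmap : (gaussianReal 0 1).map (fun x => m - σ * x)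
      = gaussianReal m (NNReal.mk (σ ^ 2) (sq_nonneg σ)) := by
    have h1 := gaussianReal_map_const_mul (μ := 0) (v := 1) σ
    have h2 := gaussianReal_map_const_sub (μ := σ * 0) (v := (NNReal.mk (σ ^ 2) (sq_nonneg σ)) * 1) m
    rw [← h1, Measure.map_map (by fun_prop) (by fun_prop)] at h2
    simpa [Function.comp_def] using h2
  rw [← hmap, map_measureReal_apply (by fun_prop) measurableSet_Ioi, stdNormalCDF, cdf_eq_real]
  refine measureReal_congr ?_
  have : (fun x => m - σ * x) ⁻¹' Set.Ioi k = Set.Iio ((m - k) / σ) := by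
    ext x
    simp only [Set.mem_preimage, Set.mem_Ioi, Set.mem_Iio, lt_div_iff₀ hσ]
    constructor <;> intro h <;> linarith
  rw [this]
  exact Iio_ae_eq_Iic

end Normal

/-! ### Central limit theorem under local alternatives. -/

section CentralLimit

variable {Ω : Type*} [MeasurableSpace Ω] {P : Measure Ω} [IsProbabilityMeasure P]

lemma charFun_map_pi_sum (Q : Measure Ω) [IsProbabilityMeasure Q] {h : Ω → ℝ} (hh : Measurable h)
    (n : ℕ) (s t : ℝ) :
    charFun ((Measure.pi fun _ : Fin n => Q).map fun x => s * ∑ i, h (x i)) t =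
      (∫ x, Complex.exp ((t * (s * h x) : ℝ) * Complex.I) ∂Q) ^ n := by
  rw [charFun_apply_real, integral_map (Measurable.aemeasurable (by fun_prop))
    (Measurable.aestronglyMeasurable (by fun_prop))]
  have e := integral_fintype_prod_eq_prod (ι := Fin n) (μ := fun _ => Q)
    (fun _ x => Complex.exp ((t * (s * h x) : ℝ) * Complex.I))
  rw [Finset.prod_const, Finset.card_univ, Fintype.card_fin] at e
  rw [← e]
  refine integral_congr_ae (ae_of_all _ fun x => ?_)
  simp only [← Complex.exp_sum, ← Finset.sum_mul]
  congr 1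
  push_cast
  simp only [Finset.mul_sum]

/-- Asymptotic normality of the normalized sums of `h` along local alternatives with tangent `g`. -/
lemma tendsto_pi_real_lt_sum {Q : ℕ → ProbabilityMeasure Ω} {g h : Ω → ℝ} (hg : IsTangent P g)
    (hh : IsTangent P h) (hpos : 0 < l2Norm P h) (hQ : IsLocalAlternative P Q g) (k : ℝ) :
    Tendsto (fun n : ℕ => (Measure.pi fun _ : Fin n => (Q n : Measure Ω)).real
        {x | k < scale n * ∑ i, h (x i)}) atTop
      (𝓝 (stdNormalCDF ((l2Inner P h g - k) / l2Norm P h))) := by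
  have hhm := hh.measurable
  have hm : ∀ n : ℕ, Measurable fun x : Fin n → Ω => scale n * ∑ i, h (x i) := fun n => by
    fun_prop
  let ν : ℕ → ProbabilityMeasure ℝ := fun n =>
    ⟨(Measure.pi fun _ : Fin n => (Q n : Measure Ω)).map fun x => scale n * ∑ i, h (x i),
      Measure.isProbabilityMeasure_map (hm n).aemeasurable⟩
  let γ : ProbabilityMeasure ℝ :=
    ⟨gaussianReal (l2Inner P h g) (NNReal.mk (l2Norm P h ^ 2) (sq_nonneg _)), inferInstance⟩
  have hν : Tendsto ν atTop (𝓝 γ) := by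
    rw [ProbabilityMeasure.tendsto_iff_tendsto_charFun]
    intro t
    change Tendsto (fun n : ℕ => charFun ((Measure.pi fun _ : Fin n => (Q n : Measure Ω)).map
      fun x => scale n * ∑ i, h (x i)) t) atTop
      (𝓝 (charFun (gaussianReal (l2Inner P h g) (NNReal.mk (l2Norm P h ^ 2) (sq_nonneg _))) t))
    rw [charFun_gaussianReal]
    -- The characteristic function of the sum is `(1 + z_n)^n` with `n z_n` convergent to the
    -- exponent of the shifted normal law.
    have h1 := Complex.tendsto_one_add_pow_exp_of_tendsto
      (tendsto_natCast_mul_integral_cexp_sub_one hg.measurable hhm hg.memLp hh.memLp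
        hh.integral_eq_zero hQ t)
    refine (h1.congr fun n => ?_).trans (le_of_eq ?_)
    · rw [charFun_map_pi_sum _ hhm, integral_sub _ (integrable_const _)]
      · simp
      · refine Integrable.of_bound (Measurable.aestronglyMeasurable (by fun_prop)) 1
          (ae_of_all _ fun x => ?_)
        rw [Complex.norm_exp_ofReal_mul_I]
    · congr 2
      simp
  have hnull : (γ : Measure ℝ) (frontier (Set.Ioi k)) = 0 := by
    have : NullSingletonClass (γ : Measure ℝ) := nullSingletonClass_gaussianReal (μ := l2Inner P h g)
      (v := (NNReal.mk (l2Norm P h ^ 2) (sq_nonneg _))) (by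
        intro h0
        exact (pow_pos hpos 2).ne' (congrArg NNReal.toReal h0))
    rw [frontier_Ioi]
    exact measure_singleton k
  have := ProbabilityMeasure.tendsto_measure_of_null_frontier_of_tendsto' hν hnull
  have h2 := (ENNReal.tendsto_toReal (measure_ne_top _ _)).comp this
  rw [← gaussianReal_real_Ioi _ _ hpos]
  refine h2.congr fun n => ?_
  exact congrArg ENNReal.toReal (Measure.map_apply (hm n) measurableSet_Ioi)

end CentralLimit

/-! ### Hellinger and total variation bounds for product measures. -/

section Hellinger

variable {α : Type*} [MeasurableSpace α] {μ P Q : Measure α} {p q : α → ℝ}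

lemma HasDensity.trans {T : Measure α} {f : α → ℝ} (hf : HasDensity T P f)
    (hp : HasDensity P μ p) : HasDensity T μ (fun x => f x * p x) where
  measurable := hf.measurable.mul hp.measurable
  nonneg x := mul_nonneg (hf.nonneg x) (hp.nonneg x)
  eq_withDensity := by
    have h1 := hf.eq_withDensity
    rw [hp.eq_withDensity, ← withDensity_mul _ hp.measurable.ennreal_ofReal
      hf.measurable.ennreal_ofReal] at h1
    rw [h1]
    congr 1
    ext x
    rw [Pi.mul_apply, mul_comm, ENNReal.ofReal_mul (hf.nonneg x)]

lemma HasDensity.pi [SigmaFinite μ] [IsProbabilityMeasure P] (hp : HasDensity P μ p) (n : ℕ) :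
    HasDensity (Measure.pi fun _ : Fin n => P) (Measure.pi fun _ : Fin n => μ)
      (fun x => ∏ i, p (x i)) where
  measurable := by
    have := hp.measurable
    fun_prop
  nonneg x := Finset.prod_nonneg fun i _ => hp.nonneg _
  eq_withDensity := by
    refine Measure.pi_eq fun s hs => ?_
    have hr : ∀ i, Integrable p (μ.restrict (s i)) := fun i => hp.integrable.restrict
    rw [withDensity_apply _ (MeasurableSet.univ_pi hs), Measure.restrict_pi_pi,
      ← ofReal_integral_eq_lintegral_ofReal (Integrable.fintype_prod hr)
        (ae_of_all _ fun x => Finset.prod_nonneg fun i _ => hp.nonneg _),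
      integral_fintype_prod_eq_prod (f := fun _ => p),
      ENNReal.ofReal_prod_of_nonneg fun i _ => integral_nonneg hp.nonneg]
    refine Finset.prod_congr rfl fun i _ => ?_
    rw [ofReal_integral_eq_lintegral_ofReal (hr i) (ae_of_all _ hp.nonneg),
      ← withDensity_apply _ (hs i), ← hp.eq_withDensity]

lemma integral_sq_sqrt_sub_sqrt [IsProbabilityMeasure P] [IsProbabilityMeasure Q]
    (hp : HasDensity P μ p) (hq : HasDensity Q μ q) :
    ∫ x, (√(p x) - √(q x)) ^ 2 ∂μ = 2 - 2 * ∫ x, √(p x) * √(q x) ∂μ := by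
  have i1 : Integrable (fun x => √(p x) * √(q x)) μ := hp.memLp_sqrt.integrable_mul hq.memLp_sqrt
  have : ∀ x, (√(p x) - √(q x)) ^ 2 = (p x + q x) - 2 * (√(p x) * √(q x)) := fun x => by
    linear_combination Real.sq_sqrt (hp.nonneg x) + Real.sq_sqrt (hq.nonneg x)
  have i2 : Integrable (fun x => p x + q x) μ := hp.integrable.add hq.integrable
  simp_rw [this]
  rw [integral_sub i2 (i1.const_mul 2),
    integral_add hp.integrable hq.integrable, integral_const_mul, hp.integral_density,
    hq.integral_density]
  norm_num

/-- Factor `p - q = (√p - √q)(√p + √q)` and apply Cauchy–Schwarz; the constant is the root of `∫ (√p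
+ √q)² ≤ 2 ∫ (p + q) = 4`. -/
lemma abs_integral_sub_integral_le [IsProbabilityMeasure P] [IsProbabilityMeasure Q]
    (hp : HasDensity P μ p) (hq : HasDensity Q μ q) {δ : α → ℝ} (hδ : Measurable δ)
    (hδ01 : ∀ x, 0 ≤ δ x ∧ δ x ≤ 1) :
    |(∫ x, δ x ∂P) - ∫ x, δ x ∂Q| ≤ 2 * √(∫ x, (√(p x) - √(q x)) ^ 2 ∂μ) := by
  have hδ1 : ∀ x, ‖δ x‖ ≤ 1 := fun x => by
    rw [Real.norm_of_nonneg (hδ01 x).1]; exact (hδ01 x).2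
  have iP : Integrable δ P := Integrable.of_bound hδ.aestronglyMeasurable 1 (ae_of_all _ hδ1)
  have iQ : Integrable δ Q := Integrable.of_bound hδ.aestronglyMeasurable 1 (ae_of_all _ hδ1)
  have hs := hp.memLp_sqrt.sub hq.memLp_sqrt
  have ha := hp.memLp_sqrt.add hq.memLp_sqrt
  rw [hp.integral_eq, hq.integral_eq,
    ← integral_sub (hp.integrable_iff.1 iP) (hq.integrable_iff.1 iQ)]
  refine (abs_integral_le_integral_abs).trans ?_
  have h1 : ∫ x, |p x • δ x - q x • δ x| ∂μ
      ≤ ∫ x, |√(p x) - √(q x)| * |√(p x) + √(q x)| ∂μ := by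
    refine integral_mono_of_nonneg (ae_of_all _ fun x => abs_nonneg _)
      (integrable_abs_mul_abs hs ha) (ae_of_all _ fun x => ?_)
    have : p x • δ x - q x • δ x = (√(p x) - √(q x)) * (√(p x) + √(q x)) * δ x := by
      simp only [smul_eq_mul]
      linear_combination (-δ x) * Real.sq_sqrt (hp.nonneg x) + δ x * Real.sq_sqrt (hq.nonneg x)
    simp only [this, abs_mul]
    exact mul_le_of_le_one_right (by positivity) (hδ1 x)
  refine h1.trans ((integral_abs_mul_abs_le hs ha).trans ?_)
  rw [mul_comm]
  refine mul_le_mul_of_nonneg_right ?_ (Real.sqrt_nonneg _)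
  rw [Real.sqrt_le_left (by norm_num)]
  have h2 : ∫ x, (√(p x) + √(q x)) ^ 2 ∂μ ≤ ∫ x, 2 * (p x + q x) ∂μ := by
    refine integral_mono_of_nonneg (ae_of_all _ fun x => sq_nonneg _)
      ((hp.integrable.add hq.integrable).const_mul 2) (ae_of_all _ fun x => ?_)
    have := Real.sq_sqrt (hp.nonneg x)
    have := Real.sq_sqrt (hq.nonneg x)
    change (√(p x) + √(q x)) ^ 2 ≤ 2 * (p x + q x)
    nlinarith [sq_nonneg (√(p x) - √(q x))]
  refine h2.trans ?_
  rw [integral_const_mul, integral_add hp.integrable hq.integrable, hp.integral_density,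
    hq.integral_density]
  norm_num

/-- The total variation distance of `n`-fold products is controlled by `n` times the squared
Hellinger distance of the factors. -/
lemma abs_integral_pi_sub_integral_pi_le [SigmaFinite μ] [IsProbabilityMeasure P]
    [IsProbabilityMeasure Q] (hp : HasDensity P μ p) (hq : HasDensity Q μ q) {n : ℕ}
    {δ : (Fin n → α) → ℝ} (hδ : Measurable δ) (hδ01 : ∀ x, 0 ≤ δ x ∧ δ x ≤ 1) :
    |(∫ x, δ x ∂Measure.pi fun _ : Fin n => P) - ∫ x, δ x ∂Measure.pi fun _ : Fin n => Q|
      ≤ 2 * √(n * ∫ x, (√(p x) - √(q x)) ^ 2 ∂μ) := by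
  refine (abs_integral_sub_integral_le (hp.pi n) (hq.pi n) hδ hδ01).trans ?_
  refine mul_le_mul_of_nonneg_left (Real.sqrt_le_sqrt ?_) zero_le_two
  rw [integral_sq_sqrt_sub_sqrt (hp.pi n) (hq.pi n)]
  have hρ : ∫ x : Fin n → α, √(∏ i, p (x i)) * √(∏ i, q (x i)) ∂Measure.pi (fun _ => μ)
      = (∫ x, √(p x) * √(q x) ∂μ) ^ n := by
    have e := integral_fintype_prod_eq_prod (ι := Fin n) (μ := fun _ => μ)
      (fun _ x => √(p x) * √(q x))
    rw [Finset.prod_const, Finset.card_univ, Fintype.card_fin] at e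
    rw [← e]
    refine integral_congr_ae (ae_of_all _ fun x => ?_)
    simp only [Finset.prod_mul_distrib]
    rw [Real.sqrt_prod _ fun i _ => hp.nonneg _, Real.sqrt_prod _ fun i _ => hq.nonneg _]
  have h0 : 0 ≤ ∫ x, √(p x) * √(q x) ∂μ := integral_nonneg fun x => by positivity
  have hH := integral_sq_sqrt_sub_sqrt hp hq
  -- The affinity `ρ = ∫ √p √q` is multiplicative over products, and Bernoulli's inequality gives `1
  -- - ρ^n ≤ n (1 - ρ)`.
  have hb := one_add_mul_le_pow (a := (∫ x, √(p x) * √(q x) ∂μ) - 1) (by linarith) n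
  rw [add_sub_cancel] at hb
  rw [hρ, hH]
  linarith

end Hellinger

/-! ### Replacing local alternatives by measures with the same root expansion. -/

section Approximation

variable {Ω : Type*} [MeasurableSpace Ω] {P : Measure Ω} [IsProbabilityMeasure P]

/-- Sequences of measures whose root densities have the same first order expansion as
local alternatives give asymptotically the same rejection probabilities. -/
lemma tendsto_integral_pi_sub_of_isLocalAlternative {Q : ℕ → ProbabilityMeasure Ω} {g : Ω → ℝ}
    (hgm : Measurable g) (hg : MemLp g 2 P) (hQ : IsLocalAlternative P Q g) {T : ℕ → Measure Ω}
    [∀ n, IsProbabilityMeasure (T n)] {f : ℕ → Ω → ℝ} (hf : ∀ n, HasDensity (T n) P (f n))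
    (hlim : Tendsto (fun n : ℕ => (n : ℝ) * ∫ x, (√(f n x) - (1 + scale n / 2 * g x)) ^ 2 ∂P)
      atTop (𝓝 0)) {δ : (n : ℕ) → (Fin n → Ω) → ℝ} (hδ : IsTest δ) :
    Tendsto (fun n => (∫ x, δ n x ∂Measure.pi fun _ : Fin n => (Q n : Measure Ω))
      - ∫ x, δ n x ∂Measure.pi fun _ : Fin n => T n) atTop (𝓝 0) := by
  set R : ℕ → ℝ := fun n => ∫ x, (√((Q n : Measure Ω).rnDeriv (P + (Q n : Measure Ω)) x).toReal
        - (1 + scale n / 2 * g x) * √(P.rnDeriv (P + (Q n : Measure Ω)) x).toReal) ^ 2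
          ∂(P + (Q n : Measure Ω)) with hR
  set S : ℕ → ℝ := fun n => ∫ x, (√(f n x) - (1 + scale n / 2 * g x)) ^ 2 ∂P with hS
  have hRS : Tendsto (fun n : ℕ => 2 * √(2 * (n * R n) + 2 * (n * S n))) atTop (𝓝 0) := by
    have h1 : Tendsto (fun n : ℕ => n * R n) atTop (𝓝 0) := hQ
    simpa using (((h1.const_mul 2).add (hlim.const_mul 2)).sqrt).const_mul 2
  refine squeeze_zero_norm (fun n => ?_) hRS
  have hp := hasDensity_rnDeriv P (P + (Q n : Measure Ω))
    (Measure.le_add_right le_rfl).absolutelyContinuous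
  have hq := hasDensity_rnDeriv (Q n : Measure Ω) (P + (Q n : Measure Ω))
    (Measure.le_add_left le_rfl).absolutelyContinuous
  set p : Ω → ℝ := fun x => (P.rnDeriv (P + (Q n : Measure Ω)) x).toReal
  set q : Ω → ℝ := fun x => ((Q n : Measure Ω).rnDeriv (P + (Q n : Measure Ω)) x).toReal
  have hw : MemLp (fun x => 1 + scale n / 2 * g x) 2 P :=
    (memLp_const (1 : ℝ)).add (hg.const_mul (scale n / 2))
  have hv : MemLp (fun x => √(f n x) - (1 + scale n / 2 * g x)) 2 P := (hf n).memLp_sqrt.sub hw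
  refine (abs_integral_pi_sub_integral_pi_le hq ((hf n).trans hp) (hδ n).1 (hδ n).2).trans ?_
  refine mul_le_mul_of_nonneg_left (Real.sqrt_le_sqrt ?_) zero_le_two
  have hfm := (hf n).measurable
  have i1 : Integrable (fun x => (√(q x) - (1 + scale n / 2 * g x) * √(p x)) ^ 2)
      (P + (Q n : Measure Ω)) :=
    (hq.memLp_sqrt.sub (hp.memLp_mul_sqrt (by fun_prop) hw)).integrable_sq
  have i2 := (hp.memLp_mul_sqrt (by fun_prop) hv).integrable_sq
  -- The triangle inequality through the common approximation `(1 + s_n g / 2) √p`, in squared form.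
  have key : ∫ x, (√(q x) - √(f n x * p x)) ^ 2 ∂(P + (Q n : Measure Ω)) ≤ 2 * R n + 2 * S n := by
    rw [hS, hR]
    dsimp only
    rw [← hp.integral_sq_mul_sqrt, ← integral_const_mul, ← integral_const_mul,
      ← integral_add (i1.const_mul 2) (i2.const_mul 2)]
    refine integral_mono_of_nonneg (ae_of_all _ fun x => sq_nonneg _)
      ((i1.const_mul 2).add (i2.const_mul 2)) (ae_of_all _ fun x => ?_)
    change (√(q x) - √(f n x * p x)) ^ 2 ≤ 2 * (√(q x) - (1 + scale n / 2 * g x) * √(p x)) ^ 2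
      + 2 * ((√(f n x) - (1 + scale n / 2 * g x)) * √(p x)) ^ 2
    rw [Real.sqrt_mul ((hf n).nonneg x)]
    nlinarith [sq_nonneg ((√(q x) - (1 + scale n / 2 * g x) * √(p x))
      + ((√(f n x) - (1 + scale n / 2 * g x)) * √(p x)))]
  calc _ ≤ (n : ℝ) * (2 * R n + 2 * S n) := by gcongr
    _ = _ := by ring

/-- This makes `P` itself the parameter `0` of the family in direction `Λ`. -/
lemma isLocalAlternative_const_zero :
    IsLocalAlternative P (fun _ => ⟨P, inferInstance⟩) 0 := by
  simp [IsLocalAlternative]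

end Approximation

/-! ### Exponential tilting, restriction and products. -/

section Tilting

variable {α : Type*} [MeasurableSpace α] {μ : Measure α}

lemma hasDensity_tilted {f : α → ℝ} (hf : Measurable f) :
    HasDensity (μ.tilted f) μ fun x => Real.exp (f x) / ∫ y, Real.exp (f y) ∂μ where
  measurable := by fun_prop
  nonneg x := div_nonneg (Real.exp_nonneg _) (integral_nonneg fun _ => Real.exp_nonneg _)
  eq_withDensity := rfl

lemma HasDensity.of_restrict {T : Measure α} {f : α → ℝ} {s : Set α} (hs : MeasurableSet s)
    (h : HasDensity T (μ.restrict s) f) : HasDensity T μ (s.indicator f) where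
  measurable := h.measurable.indicator hs
  nonneg x := Set.indicator_nonneg (fun x _ => h.nonneg x) x
  eq_withDensity := by
    rw [h.eq_withDensity, ← withDensity_indicator hs]
    congr 1
    ext x
    by_cases hx : x ∈ s <;> simp [hx]

lemma pi_tilted [IsFiniteMeasure μ] [NeZero μ] {f : α → ℝ} (hf : Measurable f)
    (hfi : Integrable (fun x => Real.exp (f x)) μ) (n : ℕ) :
    (Measure.pi fun _ : Fin n => μ.tilted f)
      = (Measure.pi fun _ : Fin n => μ).tilted fun x => ∑ i, f (x i) := by
  have := isProbabilityMeasure_tilted hfi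
  rw [((hasDensity_tilted hf).pi n).eq_withDensity, Measure.tilted]
  have e := integral_fintype_prod_eq_prod (ι := Fin n) (μ := fun _ => μ)
      (fun _ x => Real.exp (f x))
  simp only [Real.exp_sum, e, Finset.prod_div_distrib]

end Tilting

/-! ### The truncated exponential family in direction `Λ`. -/

section TruncatedTilt

variable {Ω : Type*}

/-- The set on which the scores `Λ` are not large at sample size `n`. -/
def truncSet (Λ : Ω → ℝ) (L : ℝ) (n : ℕ) : Set Ω := {x | |Λ x| ≤ √n + L}

/-- The reason for truncating: `Λ` is only square integrable, so `exp (a Λ)` need not be integrable,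
while on the truncation set the exponent is bounded uniformly in `n`. -/
lemma abs_scale_mul_le {n : ℕ} {Λ : Ω → ℝ} {L : ℝ} {x : Ω} (hL : 0 ≤ L) (hx : x ∈ truncSet Λ L n) :
    |scale n * Λ x| ≤ 1 + L := by
  have hs := scale_nonneg n
  have hx' : |Λ x| ≤ √n + L := hx
  have h1 : scale n * √n ≤ 1 := by
    rw [← natCast_mul_scale, mul_left_comm, ← pow_two]; exact natCast_mul_scale_sq_le n
  have h2 : scale n ≤ 1 := by
    rcases eq_or_ne n 0 with rfl | hn
    · simp [scale]
    · rw [scale, div_le_one (by positivity), Real.one_le_sqrt]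
      exact_mod_cast Nat.one_le_iff_ne_zero.2 hn
  rw [abs_mul, abs_of_nonneg hs]
  calc _ ≤ scale n * (√n + L) := by gcongr
    _ = scale n * √n + scale n * L := by ring
    _ ≤ 1 + 1 * L := by gcongr
    _ = _ := by ring

lemma eventually_mem_truncSet {Λ : Ω → ℝ} {L : ℝ} (hL : 0 ≤ L) (x : Ω) : ∀ᶠ n in atTop, x ∈ truncSet Λ L n := by
  have := (Real.tendsto_sqrt_atTop.comp tendsto_natCast_atTop_atTop).eventually_ge_atTop |Λ x|
  filter_upwards [this] with n hn
  exact le_add_of_le_of_nonneg hn hL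

lemma tendsto_scale_mul (c : ℝ) : Tendsto (fun n => scale n * c) atTop (𝓝 0) := by
  simpa using tendsto_scale.mul_const c

lemma abs_exp_sub_one_le_mul_exp {y B : ℝ} (hy : |y| ≤ B) : |Real.exp y - 1| ≤ |y| * Real.exp B := by
  have h1 : 1 ≤ Real.exp B := Real.one_le_exp ((abs_nonneg y).trans hy)
  have h2 := Real.add_one_le_exp y
  have h3 := Real.add_one_le_exp (-y)
  have h4 : Real.exp y * Real.exp (-y) = 1 := by rw [← Real.exp_add, add_neg_cancel, Real.exp_zero]
  have h5 : Real.exp y ≤ Real.exp B := Real.exp_le_exp.2 ((le_abs_self y).trans hy)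
  have h0 := Real.exp_pos y
  have h6 : Real.exp y - 1 ≤ y * Real.exp y := by nlinarith
  have h7 : y * Real.exp y ≤ |y| * Real.exp B := by
    calc _ ≤ |y| * Real.exp y := by gcongr; exact le_abs_self y
      _ ≤ _ := by gcongr
  rw [abs_le]
  refine ⟨?_, h6.trans h7⟩
  have h8 : |y| ≤ |y| * Real.exp B := le_mul_of_one_le_right (abs_nonneg y) h1
  linarith [neg_abs_le y]

variable [MeasurableSpace Ω]

/-- The exponential family through truncated `P` generated by the normalized scores `s_n Λ`. -/
noncomputable def truncTilt (P : Measure Ω) (Λ : Ω → ℝ) (L a : ℝ) (n : ℕ) : Measure Ω :=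
  (P.restrict (truncSet Λ L n)).tilted fun x => a * (scale n * Λ x)

variable {P : Measure Ω} {Λ : Ω → ℝ} {L : ℝ}

lemma measurableSet_truncSet (hΛ : Measurable Λ) (L : ℝ) (n : ℕ) :
    MeasurableSet (truncSet Λ L n) :=
  measurableSet_le (by fun_prop) measurable_const

/-- Such an `L` keeps the truncation set from being null at every `n`, small ones included, so that
the tilted measures are probabilities throughout. -/
lemma exists_measure_abs_le_ne_zero (P : Measure Ω) [IsProbabilityMeasure P] (Λ : Ω → ℝ) :
    ∃ L : ℝ, 0 ≤ L ∧ P {x | |Λ x| ≤ L} ≠ 0 := by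
  by_contra! h
  have : P (⋃ n : ℕ, {x | |Λ x| ≤ n}) = 0 := measure_iUnion_null fun n => h n (Nat.cast_nonneg n)
  have hu : (⋃ n : ℕ, {x | |Λ x| ≤ n}) = Set.univ :=
    Set.eq_univ_of_forall fun x => Set.mem_iUnion.2 (exists_nat_ge |Λ x|)
  rw [hu, measure_univ] at this
  exact one_ne_zero this

lemma neZero_restrict_truncSet (hL : P {x | |Λ x| ≤ L} ≠ 0) (n : ℕ) :
    NeZero (P.restrict (truncSet Λ L n)) := by
  refine ⟨fun h => hL (measure_mono_null (fun x hx => ?_) (Measure.restrict_eq_zero.1 h))⟩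
  exact le_add_of_nonneg_of_le (Real.sqrt_nonneg _) hx

lemma integrable_exp_restrict_truncSet [IsProbabilityMeasure P] (hΛ : Measurable Λ) (hL : 0 ≤ L) (a : ℝ) (n : ℕ) :
    Integrable (fun x => Real.exp (a * (scale n * Λ x))) (P.restrict (truncSet Λ L n)) := by
  refine Integrable.of_bound (Measurable.aestronglyMeasurable (by fun_prop))
    (Real.exp (|a| * (1 + L))) ?_
  filter_upwards [ae_restrict_mem (measurableSet_truncSet hΛ L n)] with x hx
  rw [Real.norm_of_nonneg (Real.exp_nonneg _), Real.exp_le_exp]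
  refine (le_abs_self _).trans ?_
  rw [abs_mul]
  gcongr
  exact abs_scale_mul_le hL hx

lemma isProbabilityMeasure_truncTilt [IsProbabilityMeasure P] (hΛ : Measurable Λ) (hL0 : 0 ≤ L)
    (hL : P {x | |Λ x| ≤ L} ≠ 0) (a : ℝ) (n : ℕ) : IsProbabilityMeasure (truncTilt P Λ L a n) := by
  have := neZero_restrict_truncSet hL n
  exact isProbabilityMeasure_tilted (integrable_exp_restrict_truncSet hΛ hL0 a n)

/-- The normalizing constant of `truncTilt`. -/
noncomputable def truncTiltConst (P : Measure Ω) (Λ : Ω → ℝ) (L a : ℝ) (n : ℕ) : ℝ :=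
  ∫ x in truncSet Λ L n, Real.exp (a * (scale n * Λ x)) ∂P

lemma hasDensity_truncTilt (hΛ : Measurable Λ) (L a : ℝ) (n : ℕ) :
    HasDensity (truncTilt P Λ L a n) P ((truncSet Λ L n).indicator fun x =>
      Real.exp (a * (scale n * Λ x)) / truncTiltConst P Λ L a n) :=
  (hasDensity_tilted (by fun_prop)).of_restrict (measurableSet_truncSet hΛ L n)

/-- The normalizing constant is `1 + o(s_n)`: the first order term is `a s_n ∫ Λ = 0`. Outside the
truncation set the integrand is `-√n`, which is dominated because `|Λ| > √n` there. -/
lemma tendsto_truncTiltConst [IsProbabilityMeasure P] (hΛ : IsTangent P Λ) (hL : 0 ≤ L) (a : ℝ) :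
    Tendsto (fun n : ℕ => √n * (truncTiltConst P Λ L a n - 1)) atTop (𝓝 0) := by
  have hΛm := hΛ.measurable
  set B : ℝ := |a| * (1 + L) with hB
  have hlim : Tendsto (fun n : ℕ => ∫ x, √n * ((truncSet Λ L n).indicator
      (fun x => Real.exp (a * (scale n * Λ x))) x - 1) ∂P) atTop (𝓝 (∫ x, a * Λ x ∂P)) := by
    refine tendsto_integral_filter_of_dominated_convergence
      (fun x => (|a| * Real.exp B + 1) * |Λ x|) ?_ ?_
      (((hΛ.memLp.integrable one_le_two).abs).const_mul _) ?_
    · refine Eventually.of_forall fun n => Measurable.aestronglyMeasurable ?_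
      exact ((Measurable.indicator (by fun_prop) (measurableSet_truncSet hΛm L n)).sub_const
        1).const_mul _
    · refine Eventually.of_forall fun n => ae_of_all _ fun x => ?_
      have hs := scale_nonneg n
      rw [norm_mul, Real.norm_of_nonneg (Real.sqrt_nonneg _), Real.norm_eq_abs]
      by_cases hx : x ∈ truncSet Λ L n
      · rw [Set.indicator_of_mem hx]
        have h1 : |a * (scale n * Λ x)| ≤ B := by
          rw [abs_mul, hB]; gcongr; exact abs_scale_mul_le hL hx
        calc _ ≤ √n * (|a * (scale n * Λ x)| * Real.exp B) := by
              gcongr; exact abs_exp_sub_one_le_mul_exp h1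
          _ = (n * scale n ^ 2) * (|a| * Real.exp B * |Λ x|) := by
              rw [← natCast_mul_scale, abs_mul, abs_mul, abs_of_nonneg hs]; ring
          _ ≤ 1 * (|a| * Real.exp B * |Λ x|) := by
              gcongr; exact natCast_mul_scale_sq_le n
          _ ≤ _ := by rw [add_mul, one_mul, one_mul]; linarith [abs_nonneg (Λ x)]
      · rw [Set.indicator_of_notMem hx]
        have h1 : √n + L < |Λ x| := not_le.1 hx
        have h2 : 0 ≤ |a| * Real.exp B * |Λ x| := by positivity
        rw [zero_sub, abs_neg, abs_one, mul_one, add_mul, one_mul]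
        linarith
    · refine ae_of_all _ fun x => ?_
      rw [tendsto_iff_norm_sub_tendsto_zero]
      have h0 : Tendsto (fun n => scale n * (a * Λ x) ^ 2) atTop (𝓝 0) := tendsto_scale_mul _
      refine squeeze_zero' (Eventually.of_forall fun n => norm_nonneg _) ?_ h0
      filter_upwards [eventually_mem_truncSet hL x, eventually_ne_atTop 0,
        (tendsto_scale_mul |a * Λ x|).eventually_le_const one_pos] with n hx hn h1
      have hs := scale_nonneg n
      have hy : |a * (scale n * Λ x)| ≤ 1 := by
        rw [mul_left_comm, abs_mul, abs_of_nonneg hs]; exact h1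
      have e : √n * ((truncSet Λ L n).indicator (fun x => Real.exp (a * (scale n * Λ x))) x - 1)
          - a * Λ x
          = n * scale n * (Real.exp (a * (scale n * Λ x)) - 1 - a * (scale n * Λ x)) := by
        rw [Set.indicator_of_mem hx, ← natCast_mul_scale]
        linear_combination (a * Λ x) * natCast_mul_scale_sq hn
      rw [e, norm_mul, Real.norm_of_nonneg (by positivity), Real.norm_eq_abs]
      calc _ ≤ n * scale n * (a * (scale n * Λ x)) ^ 2 := by
            gcongr; exact Real.abs_exp_sub_one_sub_id_le hy
        _ = (n * scale n ^ 2) * (scale n * (a * Λ x) ^ 2) := by ring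
        _ = _ := by rw [natCast_mul_scale_sq hn, one_mul]
  rw [integral_const_mul, hΛ.integral_eq_zero, mul_zero] at hlim
  refine hlim.congr fun n => ?_
  have hi : Integrable ((truncSet Λ L n).indicator fun x => Real.exp (a * (scale n * Λ x))) P :=
    (integrable_indicator_iff (measurableSet_truncSet hΛm L n)).2
      (integrable_exp_restrict_truncSet hΛm hL a n)
  rw [integral_const_mul, integral_sub hi (integrable_const 1),
    integral_indicator (measurableSet_truncSet hΛm L n), integral_const, truncTiltConst]
  simp

/-- This is the expansion of the root density before normalization, whence the exponent `a / 2`. All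
bounds are multiples of `Λ²`: off the truncation set `n ≤ Λ²`, on it the error is of first order in
`s_n Λ` and `n s_n² ≤ 1`. -/
lemma tendsto_integral_sq_indicator_exp_sub (hΛ : IsTangent P Λ) (hL : 0 ≤ L) (a : ℝ) :
    Tendsto (fun n : ℕ => (n : ℝ) * ∫ x, ((truncSet Λ L n).indicator
      (fun x => Real.exp (a / 2 * (scale n * Λ x))) x
        - (1 + scale n / 2 * (a * Λ x))) ^ 2 ∂P) atTop (𝓝 0) := by
  have hΛm := hΛ.measurable
  set B : ℝ := |a / 2| * (1 + L) with hB
  have hlim : Tendsto (fun n : ℕ => ∫ x, (n : ℝ) * ((truncSet Λ L n).indicator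
      (fun x => Real.exp (a / 2 * (scale n * Λ x))) x
        - (1 + scale n / 2 * (a * Λ x))) ^ 2 ∂P) atTop (𝓝 (∫ _, 0 ∂P)) := by
    refine tendsto_integral_filter_of_dominated_convergence
      (fun x => ((a / 2) ^ 2 * (Real.exp B + 1) ^ 2 + 2 + 2 * (a / 2) ^ 2) * Λ x ^ 2) ?_ ?_
      (hΛ.memLp.integrable_sq.const_mul _) ?_
    · refine Eventually.of_forall fun n => Measurable.aestronglyMeasurable ?_
      exact (((Measurable.indicator (by fun_prop) (measurableSet_truncSet hΛm L n)).sub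
        (by fun_prop)).pow_const 2).const_mul _
    · refine Eventually.of_forall fun n => ae_of_all _ fun x => ?_
      have hs := scale_nonneg n
      have hn1 := natCast_mul_scale_sq_le n
      rw [Real.norm_of_nonneg (by positivity)]
      by_cases hx : x ∈ truncSet Λ L n
      · rw [Set.indicator_of_mem hx]
        set y := a / 2 * (scale n * Λ x) with hy
        have h1 : |y| ≤ B := by
          rw [hy, abs_mul, hB]; gcongr; exact abs_scale_mul_le hL hx
        have h2 : |Real.exp y - (1 + scale n / 2 * (a * Λ x))| ≤ |y| * (Real.exp B + 1) := by
          have : Real.exp y - (1 + scale n / 2 * (a * Λ x)) = (Real.exp y - 1) - y := by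
            rw [hy]; ring
          rw [this]
          refine (abs_sub _ _).trans ?_
          rw [mul_add, mul_one]
          gcongr
          exact abs_exp_sub_one_le_mul_exp h1
        rw [← sq_abs]
        calc _ ≤ (n : ℝ) * (|y| * (Real.exp B + 1)) ^ 2 := by gcongr
          _ = (n * scale n ^ 2) * ((a / 2) ^ 2 * (Real.exp B + 1) ^ 2 * Λ x ^ 2) := by
              rw [mul_pow, sq_abs, hy]; ring
          _ ≤ 1 * ((a / 2) ^ 2 * (Real.exp B + 1) ^ 2 * Λ x ^ 2) := by gcongr
          _ ≤ _ := by
              rw [one_mul, add_mul, add_mul]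
              have : 0 ≤ 2 * (a / 2) ^ 2 * Λ x ^ 2 := by positivity
              linarith [sq_nonneg (Λ x)]
      · rw [Set.indicator_of_notMem hx]
        have h1 : √n + L < |Λ x| := not_le.1 hx
        have h2 : (n : ℝ) ≤ Λ x ^ 2 := by
          rw [← Real.sq_sqrt (Nat.cast_nonneg n), ← sq_abs (Λ x)]
          have := Real.sqrt_nonneg (n : ℝ)
          gcongr
          linarith
        have h3 : (0 - (1 + scale n / 2 * (a * Λ x))) ^ 2
            ≤ 2 + 2 * (scale n ^ 2 * ((a / 2) ^ 2 * Λ x ^ 2)) := by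
          nlinarith [sq_nonneg (1 - scale n / 2 * (a * Λ x))]
        calc _ ≤ (n : ℝ) * (2 + 2 * (scale n ^ 2 * ((a / 2) ^ 2 * Λ x ^ 2))) := by gcongr
          _ = 2 * n + (n * scale n ^ 2) * (2 * (a / 2) ^ 2 * Λ x ^ 2) := by ring
          _ ≤ 2 * Λ x ^ 2 + 1 * (2 * (a / 2) ^ 2 * Λ x ^ 2) := by gcongr
          _ ≤ _ := by
              have : 0 ≤ (a / 2) ^ 2 * (Real.exp B + 1) ^ 2 * Λ x ^ 2 := by positivity
              linarith
    · refine ae_of_all _ fun x => ?_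
      have h0 : Tendsto (fun n => scale n * (scale n * (a / 2 * Λ x) ^ 4)) atTop (𝓝 0) := by
        simpa using tendsto_scale.mul (tendsto_scale_mul ((a / 2 * Λ x) ^ 4))
      refine squeeze_zero' (Eventually.of_forall fun n => by positivity) ?_ h0
      filter_upwards [eventually_mem_truncSet hL x, eventually_ne_atTop 0,
        (tendsto_scale_mul |a / 2 * Λ x|).eventually_le_const one_pos] with n hx hn h1
      have hs := scale_nonneg n
      have hy : |a / 2 * (scale n * Λ x)| ≤ 1 := by
        rw [mul_left_comm, abs_mul, abs_of_nonneg hs]; exact h1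
      have e : Real.exp (a / 2 * (scale n * Λ x)) - (1 + scale n / 2 * (a * Λ x))
          = Real.exp (a / 2 * (scale n * Λ x)) - 1 - a / 2 * (scale n * Λ x) := by ring
      rw [Set.indicator_of_mem hx, e, ← sq_abs]
      calc _ ≤ (n : ℝ) * ((a / 2 * (scale n * Λ x)) ^ 2) ^ 2 := by
            gcongr; exact Real.abs_exp_sub_one_sub_id_le hy
        _ = (n * scale n ^ 2) * (scale n * (scale n * (a / 2 * Λ x) ^ 4)) := by ring
        _ = _ := by rw [natCast_mul_scale_sq hn, one_mul]
  simpa only [integral_const_mul, integral_zero] using hlim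

lemma truncTiltConst_pos [IsProbabilityMeasure P] (hΛ : Measurable Λ) (hL0 : 0 ≤ L) (hL : P {x | |Λ x| ≤ L} ≠ 0) (a : ℝ)
    (n : ℕ) : 0 < truncTiltConst P Λ L a n := by
  have := neZero_restrict_truncSet hL n
  exact integral_exp_pos (integrable_exp_restrict_truncSet hΛ hL0 a n)

/-- The root densities of the truncated exponential family have the expansion of a local
alternative with tangent `a Λ`. -/
lemma tendsto_integral_sq_sqrt_density_sub [IsProbabilityMeasure P] (hΛ : IsTangent P Λ) (hL0 : 0 ≤ L)
    (hL : P {x | |Λ x| ≤ L} ≠ 0) (a : ℝ) :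
    Tendsto (fun n : ℕ => (n : ℝ) * ∫ x, (√((truncSet Λ L n).indicator (fun x =>
      Real.exp (a * (scale n * Λ x)) / truncTiltConst P Λ L a n) x)
        - (1 + scale n / 2 * (a * Λ x))) ^ 2 ∂P) atTop (𝓝 0) := by
  have hΛm := hΛ.measurable
  have hlim : Tendsto (fun n : ℕ => 2 * (√n * (truncTiltConst P Λ L a n - 1)) ^ 2
      + 2 * ((n : ℝ) * ∫ x, ((truncSet Λ L n).indicator
      (fun x => Real.exp (a / 2 * (scale n * Λ x))) x
        - (1 + scale n / 2 * (a * Λ x))) ^ 2 ∂P)) atTop (𝓝 0) := by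
    simpa using (((tendsto_truncTiltConst hΛ hL0 a).pow 2).const_mul 2).add
      ((tendsto_integral_sq_indicator_exp_sub hΛ hL0 a).const_mul 2)
  refine squeeze_zero (fun n => by positivity) (fun n => ?_) hlim
  set Z := truncTiltConst P Λ L a n with hZ
  have hZ0 : 0 < Z := truncTiltConst_pos hΛm hL0 hL a n
  set A := truncSet Λ L n with hA
  have hAm : MeasurableSet A := measurableSet_truncSet hΛm L n
  set v : Ω → ℝ := A.indicator fun x => Real.exp (a / 2 * (scale n * Λ x)) with hv
  have hvm : Measurable v := Measurable.indicator (by fun_prop) hAm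
  have hv2 : ∀ x, v x ^ 2 = A.indicator (fun x => Real.exp (a * (scale n * Λ x))) x := fun x => by
    by_cases hx : x ∈ A
    · rw [hv, Set.indicator_of_mem hx, Set.indicator_of_mem hx, ← Real.exp_nat_mul]
      congr 1; push_cast; ring
    · rw [hv, Set.indicator_of_notMem hx, Set.indicator_of_notMem hx]; ring
  have hvi : Integrable (fun x => v x ^ 2) P := by
    simp_rw [hv2]
    exact (integrable_indicator_iff hAm).2 (integrable_exp_restrict_truncSet hΛm hL0 a n)
  have hvL : MemLp v 2 P := (memLp_two_iff_integrable_sq hvm.aestronglyMeasurable).2 hvi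
  have hvZ : ∫ x, v x ^ 2 ∂P = Z := by
    simp_rw [hv2]; rw [integral_indicator hAm]; rfl
  have hv0 : ∀ x, 0 ≤ v x := fun x => Set.indicator_nonneg (fun _ _ => Real.exp_nonneg _) x
  have hf : ∀ x, √(A.indicator (fun x => Real.exp (a * (scale n * Λ x)) / Z) x) = v x / √Z := by
    intro x
    have : A.indicator (fun x => Real.exp (a * (scale n * Λ x)) / Z) x = v x ^ 2 / Z := by
      rw [hv2]; by_cases hx : x ∈ A <;> simp [hx]
    rw [this, Real.sqrt_div (sq_nonneg _), Real.sqrt_sq (hv0 x)]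
  simp_rw [hf]
  have hw : MemLp (fun x => 1 + scale n / 2 * (a * Λ x)) 2 P :=
    (memLp_const (1 : ℝ)).add ((hΛ.memLp.const_mul a).const_mul (scale n / 2))
  have i2 : Integrable (fun x => (v x - (1 + scale n / 2 * (a * Λ x))) ^ 2) P :=
    (hvL.sub hw).integrable_sq
  have hsZ : 0 < √Z := Real.sqrt_pos.2 hZ0
  have h1 : ∫ x, (v x / √Z - (1 + scale n / 2 * (a * Λ x))) ^ 2 ∂P ≤
      2 * (Z - 1) ^ 2 + 2 * ∫ x, (v x - (1 + scale n / 2 * (a * Λ x))) ^ 2 ∂P := by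
    have h2 : ∫ x, (v x / √Z - (1 + scale n / 2 * (a * Λ x))) ^ 2 ∂P ≤
        ∫ x, 2 * ((1 / √Z - 1) ^ 2 * v x ^ 2)
          + 2 * (v x - (1 + scale n / 2 * (a * Λ x))) ^ 2 ∂P := by
      refine integral_mono_of_nonneg (ae_of_all _ fun x => sq_nonneg _)
        (((hvi.const_mul _).const_mul 2).add (i2.const_mul 2)) (ae_of_all _ fun x => ?_)
      have e : v x / √Z - (1 + scale n / 2 * (a * Λ x))
        = (1 / √Z - 1) * v x + (v x - (1 + scale n / 2 * (a * Λ x))) := by ring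
      change (v x / √Z - (1 + scale n / 2 * (a * Λ x))) ^ 2 ≤ _
      rw [e]
      exact add_sq_le.trans (le_of_eq (by ring))
    rw [integral_add ((hvi.const_mul _).const_mul 2) (i2.const_mul 2), integral_const_mul,
      integral_const_mul, integral_const_mul, hvZ] at h2
    refine h2.trans (add_le_add_left ?_ _)
    refine mul_le_mul_of_nonneg_left ?_ zero_le_two
    have hq : √Z ^ 2 = Z := Real.sq_sqrt hZ0.le
    -- The normalization costs `(√Z - 1)²`, which is at most `(Z - 1)²` since `√Z + 1 ≥ 1`.
    have e : (1 / √Z - 1) ^ 2 * Z = (√Z - 1) ^ 2 := by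
      nth_rewrite 2 [← hq]
      field_simp
      ring
    rw [e]
    have : Z - 1 = (√Z - 1) * (√Z + 1) := by linear_combination -hq
    rw [this, mul_pow]
    exact le_mul_of_one_le_right (sq_nonneg _) (one_le_pow₀ (by linarith))
  calc _ ≤ (n : ℝ) * (2 * (Z - 1) ^ 2
          + 2 * ∫ x, (v x - (1 + scale n / 2 * (a * Λ x))) ^ 2 ∂P) := by gcongr
    _ = _ := by rw [mul_pow, Real.sq_sqrt (Nat.cast_nonneg n)]; ring

/-- From here on every statement about tests along multiples of `Λ` can be proved in an exact
exponential family. -/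
lemma tendsto_integral_pi_sub_truncTilt [IsProbabilityMeasure P] (hΛ : IsTangent P Λ) (hL0 : 0 ≤ L)
    (hL : P {x | |Λ x| ≤ L} ≠ 0) (a : ℝ) {Q : ℕ → ProbabilityMeasure Ω}
    (hQ : IsLocalAlternative P Q (a • Λ)) {δ : (n : ℕ) → (Fin n → Ω) → ℝ} (hδ : IsTest δ) :
    Tendsto (fun n => (∫ x, δ n x ∂Measure.pi fun _ : Fin n => (Q n : Measure Ω))
      - ∫ x, δ n x ∂Measure.pi fun _ : Fin n => truncTilt P Λ L a n) atTop (𝓝 0) := by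
  have := isProbabilityMeasure_truncTilt hΛ.measurable hL0 hL a
  exact tendsto_integral_pi_sub_of_isLocalAlternative (hΛ.measurable.const_smul a)
    (hΛ.memLp.const_smul a) hQ (hasDensity_truncTilt hΛ.measurable L a)
    (tendsto_integral_sq_sqrt_density_sub hΛ hL0 hL a) hδ

end TruncatedTilt

/-! ### Neyman–Pearson theory in an exponential family. -/

section ExponentialTilt

variable {α : Type*}

lemma abs_indicator_one_le (s : Set α) (x : α) : |s.indicator (1 : α → ℝ) x| ≤ 1 := by
  by_cases hx : x ∈ s <;> simp [hx]

variable [MeasurableSpace α]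

/-- `ν` has density `c * exp (κ S)` with respect to `μ`. -/
structure IsExpTilt (μ ν : Measure α) (S : α → ℝ) (κ c : ℝ) : Prop where
  pos : 0 < c
  integrable : Integrable (fun x => Real.exp (κ * S x)) μ
  integral_eq : ∀ f : α → ℝ, ∫ x, f x ∂ν = c * ∫ x, f x * Real.exp (κ * S x) ∂μ

lemma isExpTilt_tilted {ρ : Measure α} [IsFiniteMeasure ρ] [NeZero ρ] {S : α → ℝ}
    (hi : ∀ a : ℝ, Integrable (fun x => Real.exp (a * S x)) ρ) (a b : ℝ) :
    IsExpTilt (ρ.tilted fun x => a * S x) (ρ.tilted fun x => b * S x) S (b - a)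
      ((∫ x, Real.exp (a * S x) ∂ρ) / ∫ x, Real.exp (b * S x) ∂ρ) where
  pos := div_pos (integral_exp_pos (hi a)) (integral_exp_pos (hi b))
  integrable := by
    rw [integrable_tilted_iff (hi a)]
    refine (hi b).congr (ae_of_all _ fun x => ?_)
    simp only [smul_eq_mul, ← Real.exp_add]
    congr 1; ring
  integral_eq f := by
    have ha := (integral_exp_pos (hi a)).ne'
    have hb := (integral_exp_pos (hi b)).ne'
    rw [integral_tilted, integral_tilted, ← integral_const_mul]
    refine integral_congr_ae (ae_of_all _ fun x => ?_)
    have : b * S x = a * S x + (b - a) * S x := by ring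
    simp only [smul_eq_mul]
    nth_rewrite 1 [this]
    rw [Real.exp_add]
    field_simp

variable {μ ν : Measure α} {S : α → ℝ} {κ c k : ℝ}

lemma IsExpTilt.integrable_mul (h : IsExpTilt μ ν S κ c) {f : α → ℝ} (hf : Measurable f)
    (hf1 : ∀ x, |f x| ≤ 1) : Integrable (fun x => f x * Real.exp (κ * S x)) μ :=
  h.integrable.bdd_mul (c := 1) hf.aestronglyMeasurable (ae_of_all _ hf1)

lemma IsExpTilt.real_eq (h : IsExpTilt μ ν S κ c) {s : Set α} (hs : MeasurableSet s) :
    ν.real s = c * ∫ x, s.indicator 1 x * Real.exp (κ * S x) ∂μ := by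
  rw [← integral_indicator_one hs, h.integral_eq]

variable [IsProbabilityMeasure μ]

lemma integrable_of_abs_le_one {f : α → ℝ} (hf : Measurable f) (hf1 : ∀ x, |f x| ≤ 1) :
    Integrable f μ :=
  Integrable.of_bound hf.aestronglyMeasurable 1 (ae_of_all _ hf1)

/-- Together with `IsExpTilt.real_le_mul_exp` this bounds the constant `c` through probabilities of
events, so its limit never has to be computed. -/
lemma IsExpTilt.mul_exp_mul_real_le (h : IsExpTilt μ ν S κ c) {s : Set α} (hs : MeasurableSet s)
    {m : ℝ} (hm : ∀ x ∈ s, m ≤ κ * S x) : c * Real.exp m * μ.real s ≤ ν.real s := by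
  rw [h.real_eq hs, mul_assoc, ← integral_indicator_one hs, ← integral_const_mul]
  refine mul_le_mul_of_nonneg_left ?_ h.pos.le
  have hm1 : Measurable (s.indicator (1 : α → ℝ)) := measurable_one.indicator hs
  refine integral_mono ((integrable_of_abs_le_one hm1 (abs_indicator_one_le s)).const_mul _)
    (h.integrable_mul hm1 (abs_indicator_one_le s)) fun x => ?_
  by_cases hx : x ∈ s
  · simpa [hx] using hm x hx
  · simp [hx]

lemma IsExpTilt.real_le_mul_exp (h : IsExpTilt μ ν S κ c) {s : Set α} (hs : MeasurableSet s)
    {m : ℝ} (hm : ∀ x ∈ s, κ * S x ≤ m) : ν.real s ≤ c * Real.exp m := by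
  rw [h.real_eq hs]
  refine mul_le_mul_of_nonneg_left ?_ h.pos.le
  have hm1 : Measurable (s.indicator (1 : α → ℝ)) := measurable_one.indicator hs
  have : ∫ _, Real.exp m ∂μ = Real.exp m := by simp
  rw [← this]
  refine integral_mono (h.integrable_mul hm1 (abs_indicator_one_le s)) (integrable_const _)
    fun x => ?_
  by_cases hx : x ∈ s
  · simpa [hx] using hm x hx
  · simpa [hx] using Real.exp_nonneg m

/-- The Neyman–Pearson identity for the test `1(S > k)` in an exponential family. -/
lemma IsExpTilt.neymanPearson (h : IsExpTilt μ ν S κ c) (hκ : 0 < κ) (hS : Measurable S) (k : ℝ)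
    {δ : α → ℝ} (hδ : Measurable δ) (hδ01 : ∀ x, 0 ≤ δ x ∧ δ x ≤ 1) :
    c * ∫ x, |{x | k < S x}.indicator 1 x - δ x| *
        |Real.exp (κ * S x) - Real.exp (κ * k)| ∂μ
      = (ν.real {x | k < S x} - ∫ x, δ x ∂ν)
        - c * Real.exp (κ * k) * (μ.real {x | k < S x} - ∫ x, δ x ∂μ) := by
  have hs : MeasurableSet {x | k < S x} := measurableSet_lt measurable_const hS
  have hm1 : Measurable ({x | k < S x}.indicator (1 : α → ℝ)) := measurable_one.indicator hs
  have hδ1 : ∀ x, |δ x| ≤ 1 := fun x => by rw [abs_of_nonneg (hδ01 x).1]; exact (hδ01 x).2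
  have i1 := integrable_of_abs_le_one (μ := μ) hm1 (abs_indicator_one_le _)
  have i2 := integrable_of_abs_le_one (μ := μ) hδ hδ1
  have i3 := h.integrable_mul hm1 (abs_indicator_one_le _)
  have i4 := h.integrable_mul hδ hδ1
  -- As `κ > 0`, both factors have the same sign on either side of `S = k`, so the absolute values
  -- can be dropped from the product.
  have hpt : ∀ x, |{x | k < S x}.indicator 1 x - δ x| *
        |Real.exp (κ * S x) - Real.exp (κ * k)| =
      ({x | k < S x}.indicator 1 x * Real.exp (κ * S x) - δ x * Real.exp (κ * S x))
        - Real.exp (κ * k) * ({x | k < S x}.indicator 1 x - δ x) := fun x => by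
    by_cases hx : k < S x
    · have h1 : Real.exp (κ * k) ≤ Real.exp (κ * S x) := by gcongr
      have h2 : (0 : ℝ) ≤ 1 - δ x := by linarith [(hδ01 x).2]
      rw [Set.indicator_of_mem (show x ∈ {x | k < S x} from hx), Pi.one_apply,
        abs_of_nonneg (sub_nonneg.2 h1), abs_of_nonneg h2]
      ring
    · have h1 : Real.exp (κ * S x) ≤ Real.exp (κ * k) := by
        have := not_lt.1 hx
        gcongr
      rw [Set.indicator_of_notMem (show x ∉ {x | k < S x} from hx),
        abs_of_nonpos (sub_nonpos.2 h1), abs_of_nonpos (by linarith [(hδ01 x).1])]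
      ring
  simp_rw [hpt]
  have i34 : Integrable (fun x => {x | k < S x}.indicator 1 x * Real.exp (κ * S x)
    - δ x * Real.exp (κ * S x)) μ := i3.sub i4
  have i12 : Integrable (fun x => {x | k < S x}.indicator 1 x - δ x) μ := i1.sub i2
  rw [integral_sub i34 (i12.const_mul _), integral_sub i3 i4, integral_const_mul,
    integral_sub i1 i2, integral_indicator_one hs, h.real_eq hs, h.integral_eq δ]
  ring

/-- Above `k` the relative gap is at least `exp (κη) - 1`, which is no less than `1 - exp (-κη)`
because `exp y + exp (-y) ≥ 2`; one constant thus serves both sides. -/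
lemma exp_gap_le {κ η s k : ℝ} (hκ : 0 < κ) (h : k + η < s ∨ s ≤ k - η) :
    Real.exp (κ * k) * (1 - Real.exp (-(κ * η))) ≤ |Real.exp (κ * s) - Real.exp (κ * k)| := by
  rcases h with h | h
  · have h1 : Real.exp (κ * k) * Real.exp (κ * η) ≤ Real.exp (κ * s) := by
      rw [← Real.exp_add, Real.exp_le_exp]; nlinarith
    have h2 : 2 ≤ Real.exp (κ * η) + Real.exp (-(κ * η)) := by
      linarith [Real.add_one_le_exp (κ * η), Real.add_one_le_exp (-(κ * η))]
    have := Real.exp_pos (κ * k)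
    refine le_trans ?_ (le_abs_self _)
    nlinarith
  · have h1 : Real.exp (κ * s) ≤ Real.exp (κ * k) * Real.exp (-(κ * η)) := by
      rw [← Real.exp_add, Real.exp_le_exp]; nlinarith
    rw [abs_sub_comm]
    refine le_trans ?_ (le_abs_self _)
    linarith

/-- Away from the boundary of the critical region, the Neyman–Pearson deficit controls the
distance of the tests. -/
lemma IsExpTilt.integral_abs_sub_le (h : IsExpTilt μ ν S κ c) (hκ : 0 < κ) (hS : Measurable S)
    (k : ℝ) {δ : α → ℝ} (hδ : Measurable δ) (hδ01 : ∀ x, 0 ≤ δ x ∧ δ x ≤ 1) {η : ℝ}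
    (hη : 0 < η) :
    ∫ x, |{x | k < S x}.indicator 1 x - δ x| ∂μ ≤
      (μ.real {x | k - η < S x} - μ.real {x | k + η < S x})
        + (∫ x, |{x | k < S x}.indicator 1 x - δ x| *
          |Real.exp (κ * S x) - Real.exp (κ * k)| ∂μ)
            / (Real.exp (κ * k) * (1 - Real.exp (-(κ * η)))) := by
  have hs : ∀ t, MeasurableSet {x | t < S x} := fun t => measurableSet_lt measurable_const hS
  have hm1 : ∀ t, Measurable ({x | t < S x}.indicator (1 : α → ℝ)) := fun t =>
    measurable_one.indicator (hs t)
  have hδ1 : ∀ x, |δ x| ≤ 1 := fun x => by rw [abs_of_nonneg (hδ01 x).1]; exact (hδ01 x).2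
  have hd1 : ∀ x, |{x | k < S x}.indicator 1 x - δ x| ≤ 1 := fun x => by
    have := hδ01 x
    by_cases hx : k < S x
    · rw [Set.indicator_of_mem (show x ∈ {x | k < S x} from hx), Pi.one_apply, abs_le]
      constructor <;> linarith
    · rw [Set.indicator_of_notMem (show x ∉ {x | k < S x} from hx), abs_le]
      constructor <;> linarith
  have hdm : Measurable fun x => |{x | k < S x}.indicator 1 x - δ x| := ((hm1 k).sub hδ).abs
  have hgap : 0 < 1 - Real.exp (-(κ * η)) := by
    rw [sub_pos, Real.exp_lt_one_iff]; nlinarith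
  have hm : 0 < Real.exp (κ * k) * (1 - Real.exp (-(κ * η))) := mul_pos (Real.exp_pos _) hgap
  have j1 := fun t => integrable_of_abs_le_one (μ := μ) (hm1 t) (abs_indicator_one_le _)
  have j2 : Integrable (fun x => |{x | k < S x}.indicator 1 x - δ x| *
      |Real.exp (κ * S x) - Real.exp (κ * k)|) μ :=
    ((h.integrable.sub (integrable_const _)).abs).bdd_mul (c := 1) hdm.aestronglyMeasurable
      (ae_of_all _ fun x => by rw [Real.norm_eq_abs, abs_abs]; exact hd1 x)
  have j3 : ∀ s t, Integrable (fun x => {x | s < S x}.indicator 1 x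
      - {x | t < S x}.indicator (1 : α → ℝ) x) μ := fun s t => (j1 s).sub (j1 t)
  rw [← integral_indicator_one (hs _), ← integral_indicator_one (hs _),
    ← integral_sub (j1 _) (j1 _), ← integral_div, ← integral_add (j3 _ _) (j2.div_const _)]
  refine integral_mono_of_nonneg (ae_of_all _ fun x => abs_nonneg _)
    ((j3 _ _).add (j2.div_const _)) (ae_of_all _ fun x => ?_)
  change |{x | k < S x}.indicator 1 x - δ x| ≤ ({x | k - η < S x}.indicator 1 x
    - {x | k + η < S x}.indicator 1 x) + |{x | k < S x}.indicator 1 x - δ x| *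
      |Real.exp (κ * S x) - Real.exp (κ * k)| / (Real.exp (κ * k) * (1 - Real.exp (-(κ * η))))
  -- Outside the strip `k - η < S ≤ k + η` the gap is bounded below; inside, the difference of the
  -- tests is at most `1`, the indicator of the strip.
  by_cases hx : k + η < S x ∨ S x ≤ k - η
  · have h0 : (0 : ℝ) ≤ {x | k - η < S x}.indicator 1 x - {x | k + η < S x}.indicator 1 x := by
      rcases hx with hx | hx
      · have h1 : k - η < S x := by linarith
        simp [hx, h1]
      · have h1 : ¬ k - η < S x := not_lt.2 hx
        have h2 : ¬ k + η < S x := by intro; linarith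
        simp [h1, h2]
    refine le_add_of_nonneg_of_le h0 ?_
    rw [le_div_iff₀ hm]
    exact mul_le_mul_of_nonneg_left (exp_gap_le hκ hx) (abs_nonneg _)
  · push Not at hx
    have e : ({x | k - η < S x}.indicator 1 x - {x | k + η < S x}.indicator 1 x : ℝ) = 1 := by
      have h1 : k - η < S x := hx.2
      have h2 : ¬ k + η < S x := not_lt.2 hx.1
      simp [h1, h2]
    rw [e]
    refine le_add_of_le_of_nonneg (hd1 x) (by positivity)

end ExponentialTilt

/-! ### Asymptotic optimality, uniqueness and contiguity. -/

section Sequences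

variable {X : ℕ → Type*} [∀ n, MeasurableSpace (X n)] {μ ν : (n : ℕ) → Measure (X n)}
  [∀ n, IsProbabilityMeasure (μ n)] [∀ n, IsProbabilityMeasure (ν n)] {S : (n : ℕ) → X n → ℝ}
  {κ : ℝ} {c : ℕ → ℝ}

/-- The statistics `S n` are asymptotically normal under `μ n`. -/
def IsAsympNormal (μ : (n : ℕ) → Measure (X n)) (S : (n : ℕ) → X n → ℝ) (m σ : ℝ) : Prop :=
  ∀ k, Tendsto (fun n => (μ n).real {x | k < S n x}) atTop (𝓝 (stdNormalCDF ((m - k) / σ)))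

variable {m m' σ : ℝ}

lemma real_compl_lt (hS : ∀ n, Measurable (S n)) (k : ℝ) (n : ℕ) :
    (μ n).real {x | S n x ≤ k} = 1 - (μ n).real {x | k < S n x} := by
  rw [← probReal_compl_eq_one_sub (measurableSet_lt measurable_const (hS n))]
  congr 1; ext x; simp

/-- No test of asymptotic level `Φ((m - k) / σ)` has larger asymptotic power than `1(S > k)`. -/
lemma eventually_power_le (h : ∀ n, IsExpTilt (μ n) (ν n) (S n) κ (c n)) (hκ : 0 < κ)
    (hS : ∀ n, Measurable (S n)) (hμ : IsAsympNormal μ S m σ) (hν : IsAsympNormal ν S m' σ) (k : ℝ)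
    {δ : (n : ℕ) → X n → ℝ} (hδ : ∀ n, Measurable (δ n)) (hδ01 : ∀ n x, 0 ≤ δ n x ∧ δ n x ≤ 1)
    (hlev : ∀ ε > 0, ∀ᶠ n in atTop, ∫ x, δ n x ∂μ n ≤ stdNormalCDF ((m - k) / σ) + ε) :
    ∀ ε > 0, ∀ᶠ n in atTop, ∫ x, δ n x ∂ν n ≤ stdNormalCDF ((m' - k) / σ) + ε := by
  intro ε hε
  set G := stdNormalCDF ((m - k) / σ) with hG
  have hG0 : 0 < G := stdNormalCDF_pos _
  -- The excess size is at most twice this number, that is `(G / 2)(ε / 2)`. The likelihood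
  -- threshold `c exp (κk)` is at most `2 / G`, so the excess contributes at most `ε / 2` to the
  -- power.
  have hε' : 0 < ε * G / 8 := by positivity
  filter_upwards [hlev _ hε', (hμ k).eventually_const_le (sub_lt_self G hε'),
    (hμ k).eventually_const_le (half_lt_self hG0),
    (hν k).eventually_le_const (lt_add_of_pos_right _ (half_pos hε))] with n h1 h2 h3 h4
  have hNP := (h n).neymanPearson hκ (hS n) k (hδ n) (hδ01 n)
  have hNP0 : 0 ≤ c n * ∫ x, |{x | k < S n x}.indicator 1 x - δ n x| *
        |Real.exp (κ * S n x) - Real.exp (κ * k)| ∂μ n :=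
    mul_nonneg (h n).pos.le (integral_nonneg fun x => by positivity)
  have hc := (h n).mul_exp_mul_real_le (measurableSet_lt measurable_const (hS n))
    (s := {x | k < S n x}) (m := κ * k) (fun x hx => mul_le_mul_of_nonneg_left (le_of_lt hx) hκ.le)
  have hc1 : c n * Real.exp (κ * k) * (μ n).real {x | k < S n x} ≤ 1 :=
    hc.trans measureReal_le_one
  have hC0 : 0 ≤ c n * Real.exp (κ * k) := mul_nonneg (h n).pos.le (Real.exp_nonneg _)
  have hC : c n * Real.exp (κ * k) * (G / 2) ≤ 1 :=
    (mul_le_mul_of_nonneg_left h3 hC0).trans hc1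
  have h5 : c n * Real.exp (κ * k) * (∫ x, δ n x ∂μ n - (μ n).real {x | k < S n x})
      ≤ c n * Real.exp (κ * k) * (G / 2) * (ε / 2) := by
    rw [mul_assoc (c n * Real.exp (κ * k))]
    refine mul_le_mul_of_nonneg_left ?_ hC0
    linarith
  nlinarith

/-- A test that asymptotically attains level and power of `1(S > k)` is asymptotically equal
to it. -/
lemma tendsto_integral_abs_sub (h : ∀ n, IsExpTilt (μ n) (ν n) (S n) κ (c n)) (hκ : 0 < κ)
    (hS : ∀ n, Measurable (S n)) (hμ : IsAsympNormal μ S m σ) (hν : IsAsympNormal ν S m' σ) (k : ℝ)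
    {δ : (n : ℕ) → X n → ℝ} (hδ : ∀ n, Measurable (δ n)) (hδ01 : ∀ n x, 0 ≤ δ n x ∧ δ n x ≤ 1)
    (hlev : ∀ ε > 0, ∀ᶠ n in atTop, ∫ x, δ n x ∂μ n ≤ stdNormalCDF ((m - k) / σ) + ε)
    (hpow : ∀ ε > 0, ∀ᶠ n in atTop, stdNormalCDF ((m' - k) / σ) - ε ≤ ∫ x, δ n x ∂ν n) :
    Tendsto (fun n => ∫ x, |{x | k < S n x}.indicator 1 x - δ n x| ∂μ n) atTop (𝓝 0) := by
  set G := stdNormalCDF ((m - k) / σ) with hG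
  set G' := stdNormalCDF ((m' - k) / σ) with hG'
  have hG0 : 0 < G := stdNormalCDF_pos _
  have hG1 : 0 < 1 - G' := sub_pos.2 (stdNormalCDF_lt_one _)
  rw [Metric.tendsto_nhds]
  intro ε hε
  -- By continuity of `Φ` the strip of half-width `η` around `k` has small limiting probability.
  obtain ⟨η, hη, hηε⟩ : ∃ η > 0, stdNormalCDF ((m - (k - η)) / σ)
      - stdNormalCDF ((m - (k + η)) / σ) < ε / 2 := by
    have hc : Continuous fun η : ℝ => stdNormalCDF ((m - (k - η)) / σ)
        - stdNormalCDF ((m - (k + η)) / σ) :=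
      (continuous_stdNormalCDF.comp (by fun_prop)).sub (continuous_stdNormalCDF.comp (by fun_prop))
    have h0 : Tendsto (fun η : ℝ => stdNormalCDF ((m - (k - η)) / σ)
        - stdNormalCDF ((m - (k + η)) / σ)) (𝓝[>] 0) (𝓝 0) := by
      have := hc.tendsto 0
      simp only [sub_zero, add_zero, sub_self] at this
      exact this.mono_left nhdsWithin_le_nhds
    exact ((h0.eventually_lt_const (half_pos hε)).and self_mem_nhdsWithin).exists.imp
      fun η hη => ⟨hη.2, hη.1⟩
  set gap := 1 - Real.exp (-(κ * η)) with hgapdef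
  have hgap : 0 < gap := by
    rw [hgapdef, sub_pos, Real.exp_lt_one_iff]; nlinarith
  -- Chosen so that the Neyman–Pearson deficit, at most `2 (1 + 2 / G) ε'`, is half of what is
  -- allowed after division by the lower bound `(1 - G') / 2 * gap`; the spare factor makes the
  -- inequality strict.
  set ε' := ε / 2 * ((1 - G') / 2 * gap) / (2 * (1 + 2 / G) * 2) with hε'def
  have hε' : 0 < ε' := by positivity
  filter_upwards [hlev _ hε', hpow _ hε', (hμ k).eventually_const_le (sub_lt_self G hε'),
    (hμ k).eventually_const_le (half_lt_self hG0),
    (hν k).eventually_le_const (lt_add_of_pos_right G' hε'),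
    (hν k).eventually_le_const (show G' < G' + (1 - G') / 2 by linarith),
    ((hμ (k - η)).sub (hμ (k + η))).eventually_lt_const hηε] with n h1 h2 h3 h4 h5 h6 h7
  rw [dist_zero_right, Real.norm_of_nonneg (integral_nonneg fun x => abs_nonneg _)]
  refine ((h n).integral_abs_sub_le hκ (hS n) k (hδ n) (hδ01 n) hη).trans_lt ?_
  have hNP := (h n).neymanPearson hκ (hS n) k (hδ n) (hδ01 n)
  set D := ∫ x, |{x | k < S n x}.indicator 1 x - δ n x| *
        |Real.exp (κ * S n x) - Real.exp (κ * k)| ∂μ n with hD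
  have hms : ∀ t, MeasurableSet {x | t < S n x} := fun t =>
    measurableSet_lt measurable_const (hS n)
  have hc := (h n).mul_exp_mul_real_le (hms k)
    (m := κ * k) (fun x hx => mul_le_mul_of_nonneg_left (le_of_lt hx) hκ.le)
  have hc1 : c n * Real.exp (κ * k) * (μ n).real {x | k < S n x} ≤ 1 :=
    hc.trans measureReal_le_one
  set C := c n * Real.exp (κ * k) with hCdef
  have hC0 : 0 < C := mul_pos (h n).pos (Real.exp_pos _)
  have hC : C ≤ 2 / G := by
    rw [le_div_iff₀ hG0]
    have := (mul_le_mul_of_nonneg_left h4 hC0.le).trans hc1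
    linarith
  -- On `S ≤ k` the likelihood ratio is at most `C`, while `ν` gives this event asymptotic mass `1 -
  -- G'`.
  have hClow : (1 - G') / 2 ≤ C := by
    have hm := (h n).real_le_mul_exp (s := {x | S n x ≤ k}) (m := κ * k)
      (measurableSet_le (hS n) measurable_const) (fun x hx => mul_le_mul_of_nonneg_left hx hκ.le)
    rw [real_compl_lt (μ := ν) hS] at hm
    linarith
  -- The deficit is the loss of power, at most `2 ε'`, plus `C` times the excess of size, at most `2
  -- ε'` as well.
  have hcD : c n * D ≤ 2 * (1 + 2 / G) * ε' := by
    rw [hNP]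
    have h8 : C * (∫ x, δ n x ∂μ n - (μ n).real {x | k < S n x}) ≤ 2 / G * (2 * ε') := by
      calc _ ≤ C * (2 * ε') := by
            refine mul_le_mul_of_nonneg_left ?_ hC0.le
            linarith
        _ ≤ _ := by gcongr
    linarith
  have hDle : D / (Real.exp (κ * k) * gap) < ε / 2 := by
    have e : D / (Real.exp (κ * k) * gap) = c n * D / (C * gap) := by
      have := (h n).pos.ne'
      rw [hCdef]; field_simp
    rw [e, div_lt_iff₀ (mul_pos hC0 hgap)]
    calc c n * D ≤ 2 * (1 + 2 / G) * ε' := hcD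
      _ = ε / 2 * ((1 - G') / 2 * gap) / 2 := by rw [hε'def]; field_simp
      _ < ε / 2 * ((1 - G') / 2 * gap) := half_lt_self (by positivity)
      _ ≤ ε / 2 * (C * gap) := by gcongr
  linarith

/-- Contiguity within exponential families with asymptotically normal statistics. -/
lemma tendsto_integral_of_isExpTilt (h : ∀ n, IsExpTilt (μ n) (ν n) (S n) κ (c n)) (hσ : 0 < σ)
    (hS : ∀ n, Measurable (S n)) (hμ : IsAsympNormal μ S m σ) (hν : IsAsympNormal ν S m' σ)
    {f : (n : ℕ) → X n → ℝ} (hf : ∀ n, Measurable (f n)) (hf01 : ∀ n x, 0 ≤ f n x ∧ f n x ≤ 1)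
    (hlim : Tendsto (fun n => ∫ x, f n x ∂μ n) atTop (𝓝 0)) :
    Tendsto (fun n => ∫ x, f n x ∂ν n) atTop (𝓝 0) := by
  rw [Metric.tendsto_nhds]
  intro ε hε
  -- Tightness under `ν`: asymptotically, less than `ε / 2` of its mass lies off `-L < S ≤ L`.
  obtain ⟨L, hL0, hL1, hL2⟩ : ∃ L > 0, stdNormalCDF ((m' - L) / σ) < ε / 4
      ∧ 1 - ε / 4 < stdNormalCDF ((m' - -L) / σ) := by
    have t1 : Tendsto (fun L : ℝ => stdNormalCDF ((m' - L) / σ)) atTop (𝓝 0) :=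
      tendsto_stdNormalCDF_atBot.comp
        ((tendsto_atBot_add_const_left _ m' tendsto_neg_atTop_atBot).atBot_div_const hσ)
    have t2 : Tendsto (fun L : ℝ => stdNormalCDF ((m' - -L) / σ)) atTop (𝓝 1) := by
      simp only [sub_neg_eq_add]
      exact tendsto_stdNormalCDF_atTop.comp
        ((tendsto_atTop_add_const_left _ m' tendsto_id).atTop_div_const hσ)
    have hε4 : 0 < ε / 4 := by positivity
    exact ((eventually_gt_atTop 0).and ((t1.eventually_lt_const hε4).and
      (t2.eventually_const_lt (sub_lt_self 1 hε4)))).exists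
  set g := stdNormalCDF ((m - -L) / σ) - stdNormalCDF ((m - L) / σ) with hg
  have hg0 : 0 < g := sub_pos.2 (strictMono_stdNormalCDF (by gcongr; linarith))
  set B := Real.exp (|κ| * L) with hB
  have hB0 : 0 < B := Real.exp_pos _
  have hε' : 0 < ε / 2 * (g / 2) / (B * B) := by positivity
  filter_upwards [hlim.eventually_lt_const hε', (hν L).eventually_lt_const hL1,
    (hν (-L)).eventually_const_lt hL2,
    ((hμ (-L)).sub (hμ L)).eventually_const_lt (half_lt_self hg0)] with n h1 h2 h3 h4
  rw [dist_zero_right, Real.norm_of_nonneg (integral_nonneg fun x => (hf01 n x).1)]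
  have hms : ∀ t, MeasurableSet {x | t < S n x} := fun t =>
    measurableSet_lt measurable_const (hS n)
  have hf1 : ∀ x, |f n x| ≤ 1 := fun x => by rw [abs_of_nonneg (hf01 n x).1]; exact (hf01 n x).2
  set K : Set (X n) := {x | -L < S n x} \ {x | L < S n x} with hK
  have hKm : MeasurableSet K := (hms _).diff (hms _)
  have hsub : {x | L < S n x} ⊆ {x | -L < S n x} := fun x hx => by
    have hx' : L < S n x := hx
    change -L < S n x
    linarith
  have hKμ : (μ n).real K = (μ n).real {x | -L < S n x} - (μ n).real {x | L < S n x} :=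
    measureReal_sdiff hsub (hms _)
  have hKν : (ν n).real K = (ν n).real {x | -L < S n x} - (ν n).real {x | L < S n x} :=
    measureReal_sdiff hsub (hms _)
  have hKS : ∀ x ∈ K, |κ * S n x| ≤ |κ| * L := fun x hx => by
    rw [abs_mul]
    exact mul_le_mul_of_nonneg_left (abs_le.2 ⟨le_of_lt hx.1, not_lt.1 hx.2⟩) (abs_nonneg _)
  -- On `K` the likelihood ratio is at least `c / B`, and `μ` gives `K` mass at least `g / 2`; hence
  -- `c` stays bounded, whatever the sign of `κ`.
  have hcB : c n * (g / 2) ≤ B := by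
    have hm := (h n).mul_exp_mul_real_le hKm (m := -(|κ| * L)) fun x hx => (abs_le.1 (hKS x hx)).1
    have hm1 := hm.trans measureReal_le_one
    rw [Real.exp_neg, ← hB, hKμ, mul_right_comm, ← div_eq_mul_inv, div_le_one hB0] at hm1
    refine le_trans ?_ hm1
    exact mul_le_mul_of_nonneg_left h4.le (h n).pos.le
  have i1 := integrable_of_abs_le_one (μ := ν n) (hf n) hf1
  have hKc : Measurable (Kᶜ.indicator (1 : X n → ℝ)) := measurable_one.indicator hKm.compl
  have hKi : Measurable (K.indicator (1 : X n → ℝ)) := measurable_one.indicator hKm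
  have hfK : Measurable fun x => K.indicator 1 x * f n x := hKi.mul (hf n)
  have hfK1 : ∀ x, |K.indicator 1 x * f n x| ≤ 1 := fun x => by
    rw [abs_mul]; exact mul_le_one₀ (abs_indicator_one_le K x) (abs_nonneg _) (hf1 x)
  have j1 := integrable_of_abs_le_one (μ := ν n) hKc (abs_indicator_one_le _)
  have j2 := integrable_of_abs_le_one (μ := ν n) hfK hfK1
  have step1 : ∫ x, f n x ∂ν n ≤ (1 - (ν n).real K) + ∫ x, K.indicator 1 x * f n x ∂ν n := by
    rw [← probReal_compl_eq_one_sub hKm, ← integral_indicator_one hKm.compl,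
      ← integral_add j1 j2]
    refine integral_mono i1 (j1.add j2) fun x => ?_
    by_cases hx : x ∈ K
    · simp [hx]
    · simpa [hx] using (hf01 n x).2
  have step2 : ∫ x, K.indicator 1 x * f n x ∂ν n ≤ c n * (B * ∫ x, f n x ∂μ n) := by
    rw [(h n).integral_eq]
    refine mul_le_mul_of_nonneg_left ?_ (h n).pos.le
    rw [← integral_const_mul]
    refine integral_mono ((h n).integrable_mul hfK hfK1)
      ((integrable_of_abs_le_one (hf n) hf1).const_mul B) fun x => ?_
    have h0 := (hf01 n x).1
    by_cases hx : x ∈ K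
    · have : Real.exp (κ * S n x) ≤ B := Real.exp_le_exp.2 (abs_le.1 (hKS x hx)).2
      simp only [Set.indicator_of_mem hx, Pi.one_apply, one_mul]
      rw [mul_comm]
      gcongr
    · simp only [Set.indicator_of_notMem hx, zero_mul]
      positivity
  have step3 : c n * (B * ∫ x, f n x ∂μ n) < ε / 2 := by
    calc c n * (B * ∫ x, f n x ∂μ n)
        < c n * (B * (ε / 2 * (g / 2) / (B * B))) := by
          have := (h n).pos
          gcongr
      _ = c n * (g / 2) * (ε / 2) / B := by field_simp
      _ ≤ B * (ε / 2) / B := by gcongr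
      _ = ε / 2 := by field_simp
  linarith

end Sequences

/-! ### Transfer to local alternatives in direction `Λ`. -/

section ProductFamily

lemma eventually_le_of_tendsto_sub {u v : ℕ → ℝ} (h : Tendsto (fun n => u n - v n) atTop (𝓝 0))
    {G : ℝ} (hu : ∀ ε > 0, ∀ᶠ n in atTop, u n ≤ G + ε) : ∀ ε > 0, ∀ᶠ n in atTop, v n ≤ G + ε := by
  intro ε hε
  filter_upwards [hu _ (half_pos hε), h.eventually_const_le (neg_lt_zero.2 (half_pos hε))]
    with n h1 h2
  linarith

lemma tendsto_sub_comm {u v : ℕ → ℝ} (h : Tendsto (fun n => u n - v n) atTop (𝓝 0)) :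
    Tendsto (fun n => v n - u n) atTop (𝓝 0) := by
  simpa using h.neg

variable {Ω : Type*} [MeasurableSpace Ω] {P : Measure Ω} {Λ : Ω → ℝ} {L : ℝ}

/-- The normalized sum of scores `s_n ∑ᵢ Λ(xᵢ)`. -/
noncomputable def scoreSum (Λ : Ω → ℝ) (n : ℕ) (x : Fin n → Ω) : ℝ := scale n * ∑ i, Λ (x i)

lemma measurable_scoreSum (hΛ : Measurable Λ) (n : ℕ) : Measurable (scoreSum Λ n) := by
  unfold scoreSum; fun_prop

lemma isTest_indicator {A : (n : ℕ) → Set (Fin n → Ω)} (hA : ∀ n, MeasurableSet (A n)) :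
    IsTest fun n => (A n).indicator 1 := fun n =>
  ⟨measurable_one.indicator (hA n), fun x => by by_cases hx : x ∈ A n <;> simp [hx]⟩

lemma measurableSet_lt_scoreSum (hΛ : Measurable Λ) (k : ℝ) (n : ℕ) :
    MeasurableSet {x | k < scoreSum Λ n x} :=
  measurableSet_lt measurable_const (measurable_scoreSum hΛ n)

lemma l2Norm_sq (P : Measure Ω) (f : Ω → ℝ) : l2Norm P f ^ 2 = ∫ x, f x ^ 2 ∂P :=
  Real.sq_sqrt (integral_nonneg fun _ => sq_nonneg _)

lemma l2Inner_smul_right (P : Measure Ω) (f g : Ω → ℝ) (c : ℝ) :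
    l2Inner P f (c • g) = c * l2Inner P f g := by
  simp only [l2Inner, Pi.smul_apply, smul_eq_mul, ← integral_const_mul]
  congr 1; ext x; ring

lemma l2Inner_self (P : Measure Ω) (f : Ω → ℝ) : l2Inner P f f = l2Norm P f ^ 2 := by
  rw [l2Norm_sq, l2Inner]; congr 1; ext x; ring

lemma IsTangent.const_smul {g : Ω → ℝ} (hg : IsTangent P g) (c : ℝ) : IsTangent P (c • g) where
  measurable := hg.measurable.const_smul c
  memLp := hg.memLp.const_smul c
  integral_eq_zero := by
    simp only [Pi.smul_apply, smul_eq_mul, integral_const_mul, hg.integral_eq_zero, mul_zero]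

variable [IsProbabilityMeasure P]

/-- The tilts of the factors multiply to a tilt of the product by the score sum, which is therefore
the sufficient statistic. -/
lemma isExpTilt_pi_truncTilt (hΛ : Measurable Λ) (hL0 : 0 ≤ L) (hL : P {x | |Λ x| ≤ L} ≠ 0)
    (a b : ℝ) (n : ℕ) :
    ∃ c, IsExpTilt (Measure.pi fun _ : Fin n => truncTilt P Λ L a n)
      (Measure.pi fun _ : Fin n => truncTilt P Λ L b n) (scoreSum Λ n) (b - a) c := by
  have h0 := neZero_restrict_truncSet hL n
  have hpi : ∀ a, (Measure.pi fun _ : Fin n => truncTilt P Λ L a n)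
      = (Measure.pi fun _ : Fin n => P.restrict (truncSet Λ L n)).tilted
        fun x => a * scoreSum Λ n x := fun a => by
    simp only [truncTilt]
    rw [pi_tilted (by fun_prop) (integrable_exp_restrict_truncSet hΛ hL0 a n)]
    congr 1
    ext x
    rw [scoreSum, Finset.mul_sum, Finset.mul_sum]
  have hi : ∀ a : ℝ, Integrable (fun x => Real.exp (a * scoreSum Λ n x))
      (Measure.pi fun _ : Fin n => P.restrict (truncSet Λ L n)) := fun a => by
    have := Integrable.fintype_prod (ι := Fin n) (fun _ =>
      integrable_exp_restrict_truncSet (P := P) hΛ hL0 a n)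
    refine this.congr (ae_of_all _ fun x => ?_)
    simp only [scoreSum, Finset.mul_sum, Real.exp_sum]
  have : NeZero (Measure.pi fun _ : Fin n => P.restrict (truncSet Λ L n)) := by
    refine ⟨fun h => ?_⟩
    have hu := Measure.pi_univ fun _ : Fin n => P.restrict (truncSet Λ L n)
    rw [h, Measure.coe_zero, Pi.zero_apply, eq_comm, Finset.prod_eq_zero_iff] at hu
    obtain ⟨_, _, hu⟩ := hu
    exact h0.out (Measure.measure_univ_eq_zero.1 hu)
  rw [hpi, hpi]
  exact ⟨_, isExpTilt_tilted hi a b⟩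

/-- The limit law is inherited from the local alternatives by applying the comparison of rejection
probabilities to the test `1(S > k)`. -/
lemma isAsympNormal_pi_truncTilt (hΛ : IsTangent P Λ) (hpos : 0 < l2Norm P Λ) (hL0 : 0 ≤ L)
    (hL : P {x | |Λ x| ≤ L} ≠ 0) (a : ℝ) {Q : ℕ → ProbabilityMeasure Ω}
    (hQ : IsLocalAlternative P Q (a • Λ)) :
    IsAsympNormal (fun n => Measure.pi fun _ : Fin n => truncTilt P Λ L a n) (scoreSum Λ)
      (a * l2Norm P Λ ^ 2) (l2Norm P Λ) := by
  intro k
  have h1 := tendsto_pi_real_lt_sum (hΛ.const_smul a) hΛ hpos hQ k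
  have hm := measurableSet_lt_scoreSum hΛ.measurable k
  have h2 := tendsto_integral_pi_sub_truncTilt hΛ hL0 hL a hQ (isTest_indicator hm)
  rw [l2Inner_smul_right, l2Inner_self] at h1
  have h3 := h1.sub h2
  rw [sub_zero] at h3
  refine h3.congr fun n => ?_
  rw [integral_indicator_one (hm n), integral_indicator_one (hm n)]
  exact sub_sub_cancel _ _

variable {a b : ℝ} {Q₀ Q₁ : ℕ → ProbabilityMeasure Ω}

/-- Asymptotic Neyman–Pearson bound along local alternatives in one direction `Λ`. -/
lemma eventually_localPower_le (hΛ : IsTangent P Λ) (hpos : 0 < l2Norm P Λ) (hab : a < b)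
    (hQ₀ : IsLocalAlternative P Q₀ (a • Λ)) (hQ₁ : IsLocalAlternative P Q₁ (b • Λ)) (k : ℝ)
    {δ : (n : ℕ) → (Fin n → Ω) → ℝ} (hδ : IsTest δ)
    (hlev : ∀ ε > 0, ∀ᶠ n in atTop, ∫ x, δ n x ∂Measure.pi (fun _ : Fin n => (Q₀ n : Measure Ω))
      ≤ stdNormalCDF ((a * l2Norm P Λ ^ 2 - k) / l2Norm P Λ) + ε) :
    ∀ ε > 0, ∀ᶠ n in atTop, ∫ x, δ n x ∂Measure.pi (fun _ : Fin n => (Q₁ n : Measure Ω))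
      ≤ stdNormalCDF ((b * l2Norm P Λ ^ 2 - k) / l2Norm P Λ) + ε := by
  obtain ⟨L, hL0, hL⟩ := exists_measure_abs_le_ne_zero P Λ
  have := isProbabilityMeasure_truncTilt hΛ.measurable hL0 hL
  choose c hc using isExpTilt_pi_truncTilt hΛ.measurable hL0 hL a b
  refine eventually_le_of_tendsto_sub
    (tendsto_sub_comm (tendsto_integral_pi_sub_truncTilt hΛ hL0 hL b hQ₁ hδ)) ?_
  exact eventually_power_le hc (sub_pos.2 hab) (measurable_scoreSum hΛ.measurable)
    (isAsympNormal_pi_truncTilt hΛ hpos hL0 hL a hQ₀)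
    (isAsympNormal_pi_truncTilt hΛ hpos hL0 hL b hQ₁) k (fun n => (hδ n).1) (fun n => (hδ n).2)
    (eventually_le_of_tendsto_sub (tendsto_integral_pi_sub_truncTilt hΛ hL0 hL a hQ₀ hδ) hlev)

/-- Asymptotic uniqueness of the optimal test along local alternatives in one direction `Λ`. -/
lemma tendsto_integral_abs_sub_of_optimal (hΛ : IsTangent P Λ) (hpos : 0 < l2Norm P Λ)
    (hab : a < b) (hQ₀ : IsLocalAlternative P Q₀ (a • Λ)) (hQ₁ : IsLocalAlternative P Q₁ (b • Λ))
    (k : ℝ) {δ : (n : ℕ) → (Fin n → Ω) → ℝ} (hδ : IsTest δ)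
    (hlev : ∀ ε > 0, ∀ᶠ n in atTop, ∫ x, δ n x ∂Measure.pi (fun _ : Fin n => (Q₀ n : Measure Ω))
      ≤ stdNormalCDF ((a * l2Norm P Λ ^ 2 - k) / l2Norm P Λ) + ε)
    (hpow : ∀ ε > 0, ∀ᶠ n in atTop, stdNormalCDF ((b * l2Norm P Λ ^ 2 - k) / l2Norm P Λ) - ε ≤
      ∫ x, δ n x ∂Measure.pi (fun _ : Fin n => (Q₁ n : Measure Ω))) :
    Tendsto (fun n => ∫ x, |{x | k < scoreSum Λ n x}.indicator 1 x - δ n x|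
      ∂Measure.pi (fun _ : Fin n => P)) atTop (𝓝 0) := by
  obtain ⟨L, hL0, hL⟩ := exists_measure_abs_le_ne_zero P Λ
  have := isProbabilityMeasure_truncTilt hΛ.measurable hL0 hL
  choose c hc using isExpTilt_pi_truncTilt hΛ.measurable hL0 hL a b
  choose c' hc' using isExpTilt_pi_truncTilt hΛ.measurable hL0 hL a 0
  have hS := measurable_scoreSum hΛ.measurable
  have hP : IsLocalAlternative P (fun _ => ⟨P, inferInstance⟩) ((0 : ℝ) • Λ) := by
    rw [zero_smul]; exact isLocalAlternative_const_zero
  have hNa := isAsympNormal_pi_truncTilt hΛ hpos hL0 hL a hQ₀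
  have hNb := isAsympNormal_pi_truncTilt hΛ hpos hL0 hL b hQ₁
  have hN0 := isAsympNormal_pi_truncTilt hΛ hpos hL0 hL 0 hP
  have hφ := isTest_indicator (measurableSet_lt_scoreSum hΛ.measurable k)
  -- The distance of the two tests takes values in `[0, 1]`, so it is itself a test: the comparison
  -- and contiguity lemmas carry its integral from parameter `a` to parameter `0` and on to `P`.
  have hD : IsTest fun n x => |{x | k < scoreSum Λ n x}.indicator 1 x - δ n x| := fun n =>
    ⟨((hφ n).1.sub (hδ n).1).abs, fun x => ⟨abs_nonneg _, by
      have h1 := (hφ n).2 x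
      have h2 := (hδ n).2 x
      rw [abs_le]
      constructor <;> linarith⟩⟩
  have hpow' : ∀ ε > 0, ∀ᶠ n in atTop, stdNormalCDF ((b * l2Norm P Λ ^ 2 - k) / l2Norm P Λ) - ε ≤
      ∫ x, δ n x ∂Measure.pi (fun _ : Fin n => truncTilt P Λ L b n) := by
    intro ε hε
    filter_upwards [hpow _ (half_pos hε), (tendsto_integral_pi_sub_truncTilt hΛ hL0 hL b hQ₁
      hδ).eventually_le_const (half_pos hε)] with n h1 h2
    linarith
  have h1 := tendsto_integral_abs_sub hc (sub_pos.2 hab) hS hNa hNb k (fun n => (hδ n).1)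
    (fun n => (hδ n).2)
    (eventually_le_of_tendsto_sub (tendsto_integral_pi_sub_truncTilt hΛ hL0 hL a hQ₀ hδ) hlev) hpow'
  have h2 := tendsto_integral_of_isExpTilt hc' hpos hS hNa hN0 (fun n => (hD n).1)
    (fun n => (hD n).2) h1
  have h3 := (tendsto_integral_pi_sub_truncTilt hΛ hL0 hL 0 hP hD).add h2
  rw [add_zero] at h3
  exact h3.congr fun n => sub_add_cancel _ _

end ProductFamily

/-! ### Bounds for asymptotic size and power. -/

section Rejection

variable {Ω : Type*} [MeasurableSpace Ω] {Q : ℕ → (Ω → ℝ) → ProbabilityMeasure Ω} {α : ℝ}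
  {δ : (n : ℕ) → (Fin n → Ω) → ℝ}

lemma IsTest.rejectProb_nonneg (hδ : IsTest δ) (g : Ω → ℝ) (n : ℕ) : 0 ≤ rejectProb Q δ g n :=
  integral_nonneg fun x => ((hδ n).2 x).1

lemma IsTest.rejectProb_le_one (hδ : IsTest δ) (g : Ω → ℝ) (n : ℕ) : rejectProb Q δ g n ≤ 1 := by
  have h := integral_mono_of_nonneg (μ := Measure.pi fun _ : Fin n => (Q n g : Measure Ω))
    (f := δ n) (g := fun _ => (1 : ℝ)) (ae_of_all _ fun x => ((hδ n).2 x).1) (integrable_const _)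
    (ae_of_all _ fun x => ((hδ n).2 x).2)
  simpa [rejectProb] using h

lemma IsTest.isBoundedUnder_le (hδ : IsTest δ) (g : Ω → ℝ) :
    IsBoundedUnder (· ≤ ·) atTop (rejectProb Q δ g) :=
  isBoundedUnder_of ⟨1, hδ.rejectProb_le_one g⟩

lemma IsTest.isBoundedUnder_ge (hδ : IsTest δ) (g : Ω → ℝ) :
    IsBoundedUnder (· ≥ ·) atTop (rejectProb Q δ g) :=
  isBoundedUnder_of ⟨0, hδ.rejectProb_nonneg g⟩

lemma IsTest.asyPower_nonneg (hδ : IsTest δ) (g : Ω → ℝ) : 0 ≤ asyPower Q δ g :=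
  le_liminf_of_le (hδ.isBoundedUnder_le g).isCoboundedUnder_ge
    (Eventually.of_forall (hδ.rejectProb_nonneg g))

lemma IsTest.asyPower_le_one (hδ : IsTest δ) (g : Ω → ℝ) : asyPower Q δ g ≤ 1 :=
  liminf_le_of_frequently_le (Eventually.of_forall (hδ.rejectProb_le_one g)).frequently
    (hδ.isBoundedUnder_ge g)

lemma IsTest.eventually_rejectProb_le (hδ : IsTest δ) {g : Ω → ℝ} (h : asySize Q δ g ≤ α) :
    ∀ ε > 0, ∀ᶠ n in atTop, rejectProb Q δ g n ≤ α + ε := fun _ hε =>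
  (eventually_lt_of_limsup_lt (h.trans_lt (lt_add_of_pos_right α hε))
    (hδ.isBoundedUnder_le g)).mono fun _ => le_of_lt

lemma IsTest.eventually_le_rejectProb (hδ : IsTest δ) {g : Ω → ℝ} (h : α ≤ asyPower Q δ g) :
    ∀ ε > 0, ∀ᶠ n in atTop, α - ε ≤ rejectProb Q δ g n := fun _ hε =>
  (eventually_lt_of_lt_liminf ((sub_lt_self α hε).trans_le h)
    (hδ.isBoundedUnder_ge g)).mono fun _ => le_of_lt

lemma IsTest.asyPower_le (hδ : IsTest δ) {g : Ω → ℝ}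
    (h : ∀ ε > 0, ∀ᶠ n in atTop, rejectProb Q δ g n ≤ α + ε) : asyPower Q δ g ≤ α :=
  le_of_forall_pos_le_add fun ε hε =>
    liminf_le_of_frequently_le (h ε hε).frequently (hδ.isBoundedUnder_ge g)

lemma minPower_le {G₁ : Set (Ω → ℝ)} (hδ : IsTest δ) {g : Ω → ℝ} (hg : g ∈ G₁) :
    minPower Q G₁ δ ≤ asyPower Q δ g :=
  ciInf_le (f := fun g : G₁ => asyPower Q δ g)
    ⟨0, by rintro _ ⟨g, rfl⟩; exact hδ.asyPower_nonneg _⟩ ⟨g, hg⟩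

lemma le_simplePower {g₀ g₁ : Ω → ℝ} (h : IsLevelTest Q α {g₀} δ) :
    asyPower Q δ g₁ ≤ simplePower Q α g₀ g₁ :=
  le_csSup ⟨1, by rintro _ ⟨δ, hδ, rfl⟩; exact hδ.1.asyPower_le_one _⟩ ⟨δ, h, rfl⟩

end Rejection

/-! ### Limiting rejection probabilities of the pair tests. -/

section PairTest

variable {Ω : Type*} [MeasurableSpace Ω] {P : Measure Ω}
  {Q : ℕ → (Ω → ℝ) → ProbabilityMeasure Ω} {g g₀ g₁ : Ω → ℝ} {u : ℝ}

lemma measurableSet_pairTest (h : Measurable (g₁ - g₀)) (n : ℕ) (k : ℝ) :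
    MeasurableSet {x : Fin n → Ω | scale n * ∑ i, (g₁ - g₀) (x i) > k} :=
  measurableSet_lt measurable_const (by fun_prop)

lemma isTest_pairTest (h : Measurable (g₁ - g₀)) : IsTest (pairTest P u g₀ g₁) :=
  isTest_indicator fun n => measurableSet_pairTest h n _

/-- The critical value is centered at `g₀`: the limit is `Φ(-u)` at `g = g₀` and `Φ(-u + ‖g₁ - g₀‖)`
at `g = g₁`. -/
lemma tendsto_rejectProb_pairTest [IsProbabilityMeasure P] (hg : IsTangent P g)
    (h : IsTangent P (g₁ - g₀)) (hpos : 0 < l2Norm P (g₁ - g₀))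
    (hQ : IsLocalAlternative P (fun n => Q n g) g) :
    Tendsto (rejectProb Q (pairTest P u g₀ g₁) g) atTop
      (𝓝 (stdNormalCDF (-u + (l2Inner P (g₁ - g₀) g - l2Inner P (g₁ - g₀) g₀)
        / l2Norm P (g₁ - g₀)))) := by
  have h1 := tendsto_pi_real_lt_sum hg h hpos hQ
    (l2Norm P (g₁ - g₀) * u + l2Inner P (g₁ - g₀) g₀)
  have e : (l2Inner P (g₁ - g₀) g - (l2Norm P (g₁ - g₀) * u + l2Inner P (g₁ - g₀) g₀))
        / l2Norm P (g₁ - g₀) = -u + (l2Inner P (g₁ - g₀) g - l2Inner P (g₁ - g₀) g₀)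
        / l2Norm P (g₁ - g₀) := by
    field_simp; ring
  rw [e] at h1
  exact h1.congr fun n =>
    (integral_indicator_one (measurableSet_pairTest h.measurable n _)).symm

end PairTest

/-! ### Two balls in `L₂` and their closest points. -/

section Geometry

variable {Ω : Type*} [MeasurableSpace Ω] {P : Measure Ω} {Λ f g h : Ω → ℝ}

lemma IsTangent.add (hf : IsTangent P f) (hg : IsTangent P g) [IsFiniteMeasure P] :
    IsTangent P (f + g) where
  measurable := hf.measurable.add hg.measurable
  memLp := hf.memLp.add hg.memLp
  integral_eq_zero := by
    simp only [Pi.add_apply]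
    rw [integral_add (hf.memLp.integrable one_le_two) (hg.memLp.integrable one_le_two),
      hf.integral_eq_zero, hg.integral_eq_zero, add_zero]

lemma IsTangent.sub (hf : IsTangent P f) (hg : IsTangent P g) [IsFiniteMeasure P] :
    IsTangent P (f - g) := by
  have := hf.add (hg.const_smul (-1))
  rwa [neg_one_smul, ← sub_eq_add_neg] at this

lemma l2Norm_nonneg (P : Measure Ω) (f : Ω → ℝ) : 0 ≤ l2Norm P f := Real.sqrt_nonneg _

lemma l2Inner_comm (P : Measure Ω) (f g : Ω → ℝ) : l2Inner P f g = l2Inner P g f := by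
  simp only [l2Inner, mul_comm]

lemma l2Inner_add_right (hf : MemLp f 2 P) (hg : MemLp g 2 P) (hh : MemLp h 2 P) :
    l2Inner P f (g + h) = l2Inner P f g + l2Inner P f h := by
  simp only [l2Inner, Pi.add_apply, mul_add]
  exact integral_add (hf.integrable_mul hg) (hf.integrable_mul hh)

lemma l2Inner_sub_right (hf : MemLp f 2 P) (hg : MemLp g 2 P) (hh : MemLp h 2 P) :
    l2Inner P f (g - h) = l2Inner P f g - l2Inner P f h := by
  simp only [l2Inner, Pi.sub_apply, mul_sub]
  exact integral_sub (hf.integrable_mul hg) (hf.integrable_mul hh)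

lemma abs_l2Inner_le (hf : MemLp f 2 P) (hg : MemLp g 2 P) :
    |l2Inner P f g| ≤ l2Norm P f * l2Norm P g := by
  refine (abs_integral_le_integral_abs).trans ?_
  simp only [abs_mul]
  exact integral_abs_mul_abs_le hf hg

lemma l2Norm_smul (P : Measure Ω) (c : ℝ) (f : Ω → ℝ) : l2Norm P (c • f) = |c| * l2Norm P f := by
  simp only [l2Norm, Pi.smul_apply, smul_eq_mul, mul_pow, integral_const_mul]
  rw [Real.sqrt_mul (sq_nonneg c), Real.sqrt_sq_eq_abs]

lemma l2Inner_sub_self (hf : MemLp f 2 P) (hg : MemLp g 2 P) :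
    l2Norm P (f - g) ^ 2 = l2Norm P f ^ 2 - 2 * l2Inner P f g + l2Norm P g ^ 2 := by
  rw [← l2Inner_self, ← l2Inner_self, ← l2Inner_self, l2Inner_sub_right (hf.sub hg) hf hg,
    l2Inner_comm P _ f, l2Inner_comm P _ g, l2Inner_sub_right hf hf hg, l2Inner_sub_right hg hf hg,
    l2Inner_comm P g f]
  ring

lemma ae_eq_of_l2Norm_sub_sq_le (hf : MemLp f 2 P) (hg : MemLp g 2 P)
    (h : l2Norm P (f - g) ^ 2 ≤ 0) : f =ᵐ[P] g := by
  rw [l2Norm_sq] at h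
  have h0 := (integral_eq_zero_iff_of_nonneg (fun x => sq_nonneg ((f - g) x))
    (hf.sub hg).integrable_sq).1 (le_antisymm h (integral_nonneg fun x => sq_nonneg _))
  filter_upwards [h0] with x hx
  have : (f x - g x) ^ 2 = 0 := hx
  exact sub_eq_zero.1 (pow_eq_zero_iff two_ne_zero |>.1 this)

variable {r₀ r₁ τ : ℝ}

lemma exists_of_mem_hellingerNull (hg : g ∈ hellingerNull P r₀) :
    ∃ h ∈ hellingerTangents P, g = r₀ • h := by
  obtain ⟨h, hh, rfl⟩ := Set.mem_smul_set.1 hg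
  exact ⟨h, hh, rfl⟩

lemma exists_of_mem_hellingerAlt (hg : g ∈ hellingerAlt P Λ τ r₁) :
    ∃ h ∈ hellingerTangents P, g = τ • Λ + r₁ • h := by
  obtain ⟨_, rfl, _, ⟨h, hh, rfl⟩, rfl⟩ := hg
  exact ⟨h, hh, rfl⟩

lemma l2Norm_le_of_mem (hh : h ∈ hellingerTangents P) : l2Norm P h ≤ √8 :=
  Real.sqrt_le_sqrt hh.2

lemma abs_l2Inner_le_of_mem (hΛ : IsTangent P Λ) (hh : h ∈ hellingerTangents P) :
    |l2Inner P Λ h| ≤ √8 * l2Norm P Λ := by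
  refine (abs_l2Inner_le hΛ.memLp hh.1.memLp).trans ?_
  rw [mul_comm]
  exact mul_le_mul_of_nonneg_right (l2Norm_le_of_mem hh) (l2Norm_nonneg P Λ)

lemma smul_mem_hellingerTangents (hΛ : IsTangent P Λ) {c : ℝ}
    (hc : |c| * l2Norm P Λ ≤ √8) : c • Λ ∈ hellingerTangents P := by
  refine ⟨hΛ.const_smul c, ?_⟩
  rw [← l2Norm_sq, l2Norm_smul]
  calc _ ≤ √8 ^ 2 := pow_le_pow_left₀ (mul_nonneg (abs_nonneg c) (l2Norm_nonneg P Λ)) hc 2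
    _ = 8 := Real.sq_sqrt (by norm_num)

/-- Equality in the Cauchy–Schwarz bound on the Hellinger ball. -/
lemma ae_eq_of_mem_of_l2Inner_eq (hΛ : IsTangent P Λ)
    (hh : h ∈ hellingerTangents P) {c : ℝ} (hc : |c| * l2Norm P Λ = √8)
    (heq : c * l2Inner P Λ h = 8) : h =ᵐ[P] c • Λ := by
  refine ae_eq_of_l2Norm_sub_sq_le hh.1.memLp (hΛ.memLp.const_smul c) ?_
  -- The square expands to `‖h‖² - 2 · 8 + 8`, which is at most `0` on the ball.
  rw [l2Inner_sub_self hh.1.memLp (hΛ.memLp.const_smul c), l2Inner_smul_right, l2Norm_smul, hc,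
    Real.sq_sqrt (by norm_num), l2Norm_sq, l2Inner_comm, heq]
  linarith [hh.2]

lemma isTangent_of_mem_null (hg : g ∈ hellingerNull P r₀) : IsTangent P g := by
  obtain ⟨h, hh, rfl⟩ := exists_of_mem_hellingerNull hg
  exact hh.1.const_smul r₀

lemma isTangent_of_mem_alt [IsFiniteMeasure P] (hΛ : IsTangent P Λ)
    (hg : g ∈ hellingerAlt P Λ τ r₁) : IsTangent P g := by
  obtain ⟨h, hh, rfl⟩ := exists_of_mem_hellingerAlt hg
  exact (hΛ.const_smul τ).add (hh.1.const_smul r₁)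

lemma smul_mem_hellingerNull (hΛ : IsTangent P Λ) (hpos : 0 < l2Norm P Λ) {γ : ℝ}
    (hγ : γ = √8 / l2Norm P Λ) : (r₀ * γ) • Λ ∈ hellingerNull P r₀ := by
  refine Set.mem_smul_set.2 ⟨γ • Λ, smul_mem_hellingerTangents hΛ ?_, by rw [mul_smul]⟩
  rw [hγ, abs_of_nonneg (by positivity), div_mul_cancel₀ _ hpos.ne']

lemma smul_sub_smul_mem_hellingerAlt (hΛ : IsTangent P Λ) (hpos : 0 < l2Norm P Λ) {γ : ℝ}
    (hγ : γ = √8 / l2Norm P Λ) : τ • Λ - (r₁ * γ) • Λ ∈ hellingerAlt P Λ τ r₁ := by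
  refine Set.mem_add.2 ⟨τ • Λ, rfl, r₁ • (-γ) • Λ, Set.smul_mem_smul_set
    (smul_mem_hellingerTangents hΛ ?_), ?_⟩
  · rw [hγ, abs_neg, abs_of_nonneg (by positivity), div_mul_cancel₀ _ hpos.ne']
  · rw [smul_smul, mul_neg, neg_smul, ← sub_eq_add_neg]

/-- The bound is attained at `q₀`, and that of `le_l2Inner_of_mem_alt` at `q₁`; the pair yields the
minimal distance as well as the extremal size and power of the maxmin test. -/
lemma l2Inner_le_of_mem_null (hΛ : IsTangent P Λ) (hr₀ : 0 ≤ r₀) (hg : g ∈ hellingerNull P r₀) :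
    l2Inner P Λ g ≤ r₀ * √8 * l2Norm P Λ := by
  obtain ⟨h, hh, rfl⟩ := exists_of_mem_hellingerNull hg
  rw [l2Inner_smul_right, mul_assoc]
  exact mul_le_mul_of_nonneg_left (abs_le.1 (abs_l2Inner_le_of_mem hΛ hh)).2 hr₀

lemma le_l2Inner_of_mem_alt (hΛ : IsTangent P Λ) (hr₁ : 0 ≤ r₁)
    (hg : g ∈ hellingerAlt P Λ τ r₁) :
    τ * l2Norm P Λ ^ 2 - r₁ * √8 * l2Norm P Λ ≤ l2Inner P Λ g := by
  obtain ⟨h, hh, rfl⟩ := exists_of_mem_hellingerAlt hg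
  rw [l2Inner_add_right hΛ.memLp (hΛ.memLp.const_smul τ) (hh.1.memLp.const_smul r₁),
    l2Inner_smul_right, l2Inner_smul_right, l2Inner_self]
  have := mul_le_mul_of_nonneg_left (abs_le.1 (abs_l2Inner_le_of_mem hΛ hh)).1 hr₁
  linarith

/-- The norm of `g - f` is bounded below by its component along `Λ`, to which the bounds on the two
balls apply. -/
lemma le_l2Norm_sub (hΛ : IsTangent P Λ) [IsFiniteMeasure P] (hpos : 0 < l2Norm P Λ)
    (hr₀ : 0 ≤ r₀) (hr₁ : 0 ≤ r₁) (hf : f ∈ hellingerNull P r₀) (hg : g ∈ hellingerAlt P Λ τ r₁) :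
    τ * l2Norm P Λ - √8 * (r₀ + r₁) ≤ l2Norm P (g - f) := by
  have hft := isTangent_of_mem_null hf
  have hgt := isTangent_of_mem_alt hΛ hg
  have h1 := l2Inner_le_of_mem_null hΛ hr₀ hf
  have h2 := le_l2Inner_of_mem_alt hΛ hr₁ hg
  have h3 := (abs_le.1 (abs_l2Inner_le hΛ.memLp (hgt.sub hft).memLp)).2
  rw [l2Inner_sub_right hΛ.memLp hgt.memLp hft.memLp] at h3
  have h4 : l2Norm P Λ * (τ * l2Norm P Λ - √8 * (r₀ + r₁)) ≤ l2Norm P Λ * l2Norm P (g - f) := by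
    linarith
  exact le_of_mul_le_mul_left h4 hpos

/-- At minimal distance the chain of inequalities behind `le_l2Norm_sub` is tight, so both ball
elements attain equality in Cauchy–Schwarz and are multiples of `Λ`. -/
lemma ae_eq_of_l2Norm_sub_le (hΛ : IsTangent P Λ) [IsFiniteMeasure P] (hpos : 0 < l2Norm P Λ)
    (hr₀ : 0 ≤ r₀) (hr₁ : 0 ≤ r₁) {γ : ℝ} (hγ : γ = √8 / l2Norm P Λ)
    (hf : f ∈ hellingerNull P r₀) (hg : g ∈ hellingerAlt P Λ τ r₁)
    (hle : l2Norm P (g - f) ≤ τ * l2Norm P Λ - √8 * (r₀ + r₁)) :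
    f =ᵐ[P] (r₀ * γ) • Λ ∧ g =ᵐ[P] τ • Λ - (r₁ * γ) • Λ := by
  have hft := isTangent_of_mem_null hf
  have hgt := isTangent_of_mem_alt hΛ hg
  have h1 := l2Inner_le_of_mem_null hΛ hr₀ hf
  have h2 := le_l2Inner_of_mem_alt hΛ hr₁ hg
  have h3 := (abs_le.1 (abs_l2Inner_le hΛ.memLp (hgt.sub hft).memLp)).2
  rw [l2Inner_sub_right hΛ.memLp hgt.memLp hft.memLp] at h3
  have h4 := mul_le_mul_of_nonneg_left hle hpos.le
  have hs : √8 * √8 = (8 : ℝ) := Real.mul_self_sqrt (by norm_num)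
  have hγ0 : 0 ≤ γ := by rw [hγ]; positivity
  have hγc : γ * l2Norm P Λ = √8 := by rw [hγ, div_mul_cancel₀ _ hpos.ne']
  constructor
  · obtain ⟨h, hh, rfl⟩ := exists_of_mem_hellingerNull hf
    -- For radius `0` the element `h` is not determined, but the set is a single point.
    rcases eq_or_ne r₀ 0 with rfl | hr
    · simp
    have e : r₀ * l2Inner P Λ h = r₀ * (√8 * l2Norm P Λ) := by
      rw [l2Inner_smul_right] at h1 h3
      linarith
    have e' := mul_left_cancel₀ hr e
    have := ae_eq_of_mem_of_l2Inner_eq hΛ hh (c := γ) (by rw [abs_of_nonneg hγ0, hγc])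
      (by rw [e', mul_left_comm, hγc, hs])
    filter_upwards [this] with x hx
    simp only [Pi.smul_apply, smul_eq_mul] at hx ⊢
    rw [hx]; ring
  · obtain ⟨h, hh, rfl⟩ := exists_of_mem_hellingerAlt hg
    rcases eq_or_ne r₁ 0 with rfl | hr
    · simp
    have e : r₁ * l2Inner P Λ h = r₁ * (-(√8 * l2Norm P Λ)) := by
      rw [l2Inner_add_right hΛ.memLp (hΛ.memLp.const_smul τ) (hh.1.memLp.const_smul r₁),
        l2Inner_smul_right, l2Inner_smul_right, l2Inner_self] at h2 h3
      linarith
    have e' := mul_left_cancel₀ hr e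
    have := ae_eq_of_mem_of_l2Inner_eq hΛ hh (c := -γ)
      (by rw [abs_neg, abs_of_nonneg hγ0, hγc]) (by rw [e', neg_mul_neg, mul_left_comm, hγc, hs])
    filter_upwards [this] with x hx
    simp only [Pi.smul_apply, Pi.add_apply, Pi.sub_apply, smul_eq_mul] at hx ⊢
    rw [hx]; ring

end Geometry

end AsymptoticTesting

/-! ### The maxmin theorem for Hellinger balls. -/

theorem mainTheorem4 {Ω : Type*} [MeasurableSpace Ω] (P : Measure Ω) [IsProbabilityMeasure P]
    -- the scores, the parameter shift, the two radii, the level and its upper normal point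
    (Λ : Ω → ℝ) (hΛ : IsTangent P Λ)
    (τ r₀ r₁ : ℝ) (hτ : 0 < τ) (hr₀ : 0 ≤ r₀) (hr₁ : 0 ≤ r₁)
    (hr : 8 * (r₀ + r₁) ^ 2 < τ ^ 2 * l2Norm P Λ ^ 2)
    (α : ℝ) (hα : α ∈ Set.Ioo (0 : ℝ) 1) (u : ℝ) (hu : stdNormalCDF (-u) = α)
    -- local alternatives `Q n g` along all tangents in the two hypotheses
    (Q : ℕ → (Ω → ℝ) → ProbabilityMeasure Ω)
    (hQ : ∀ g ∈ hellingerNull P r₀ ∪ hellingerAlt P Λ τ r₁,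
      IsLocalAlternative P (fun n => Q n g) g)
    (γ : ℝ) (hγ : γ = √8 / l2Norm P Λ)
    (q₀ q₁ : Ω → ℝ) (hq₀ : q₀ = (r₀ * γ) • Λ) (hq₁ : q₁ = τ • Λ - (r₁ * γ) • Λ) :
    -- least favorable pair, existence and uniqueness
    IsLeastFavorable Q α (hellingerNull P r₀) (hellingerAlt P Λ τ r₁) q₀ q₁ ∧
    (∀ g₀ g₁, IsLeastFavorable Q α (hellingerNull P r₀) (hellingerAlt P Λ τ r₁) g₀ g₁ →
      g₀ =ᵐ[P] q₀ ∧ g₁ =ᵐ[P] q₁) ∧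
    -- it is also the unique pair attaining the minimum norm in `G_{h,1} - G_{h,0}`
    IsMinNormPair P (hellingerNull P r₀) (hellingerAlt P Λ τ r₁) q₀ q₁ ∧
    (∀ g₀ g₁, IsMinNormPair P (hellingerNull P r₀) (hellingerAlt P Λ τ r₁) g₀ g₁ →
      g₀ =ᵐ[P] q₀ ∧ g₁ =ᵐ[P] q₁) ∧
    -- saddle point
    IsSaddlePoint Q α (hellingerNull P r₀) (hellingerAlt P Λ τ r₁) q₀ q₁ (pairTest P u q₀ q₁) ∧
    -- the maxmin test, its explicit form, and its uniqueness up to terms tending to 0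
    -- in probability under the `n`-fold products of `P`
    IsMaxminTest Q α (hellingerNull P r₀) (hellingerAlt P Λ τ r₁) (pairTest P u q₀ q₁) ∧
    (∀ n : ℕ, pairTest P u q₀ q₁ n =
      Set.indicator
        {x : Fin n → Ω | scale n * (l2Norm P Λ)⁻¹ * ∑ i, Λ (x i) > u + √8 * r₀} 1) ∧
    (∀ δ, IsMaxminTest Q α (hellingerNull P r₀) (hellingerAlt P Λ τ r₁) δ →
      ∀ ε > 0, Tendsto
        (fun n : ℕ => (Measure.pi fun _ : Fin n => P)
          {x | ε ≤ |δ n x - pairTest P u q₀ q₁ n x|}) atTop (𝓝 0)) ∧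
    -- the maxmin asymptotic power
    IsMaxminPower Q α (hellingerNull P r₀) (hellingerAlt P Λ τ r₁)
      (stdNormalCDF (-u + τ * l2Norm P Λ - √8 * (r₀ + r₁))) := by
  -- norms and inner products at the distinguished pair
  set σ := l2Norm P Λ with hσ
  set G₀ := hellingerNull P r₀ with hG₀
  set G₁ := hellingerAlt P Λ τ r₁ with hG₁
  have hs : √8 * √8 = (8 : ℝ) := Real.mul_self_sqrt (by norm_num)
  have hσpos : 0 < σ := by
    refine (l2Norm_nonneg P Λ).lt_of_ne fun h0 => ?_
    rw [hσ, ← h0] at hr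
    nlinarith [sq_nonneg (r₀ + r₁)]
  -- The assumption on the radii is the square of this inequality; it says that the two balls are
  -- separated.
  have hgap : 0 < τ * σ - √8 * (r₀ + r₁) := by
    have h1 : (√8 * (r₀ + r₁)) ^ 2 < (τ * σ) ^ 2 := by
      rw [mul_pow, mul_pow, Real.sq_sqrt (by norm_num)]; exact hr
    exact sub_pos.2 (lt_of_pow_lt_pow_left₀ 2 (by positivity) h1)
  set N := τ * σ - √8 * (r₀ + r₁) with hN
  have hγσ : γ * σ = √8 := by rw [hγ, div_mul_cancel₀ _ hσpos.ne']
  -- The coefficient of `Λ` in `q₁ - q₀`; its positivity gives the test the one-sided form `S_n >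
  -- k`.
  set κ := τ - (r₀ + r₁) * γ with hκ
  have hκσ : κ * σ = N := by rw [hκ, hN, ← hγσ]; ring
  have hκpos : 0 < κ := pos_of_mul_pos_left (hκσ ▸ hgap) hσpos.le
  have hq10 : q₁ - q₀ = κ • Λ := by
    rw [hq₀, hq₁, hκ, ← sub_smul, ← sub_smul]; congr 1; ring
  have hNq : l2Norm P (q₁ - q₀) = N := by
    rw [hq10, l2Norm_smul, abs_of_pos hκpos, hκσ]
  have hq₀G : q₀ ∈ G₀ := hq₀ ▸ smul_mem_hellingerNull hΛ hσpos hγ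
  have hq₁G : q₁ ∈ G₁ := hq₁ ▸ smul_sub_smul_mem_hellingerAlt hΛ hσpos hγ
  have hT₀ : ∀ g ∈ G₀, IsTangent P g := fun g hg => isTangent_of_mem_null hg
  have hT₁ : ∀ g ∈ G₁, IsTangent P g := fun g hg => isTangent_of_mem_alt hΛ hg
  have hQ₀ : ∀ g ∈ G₀, IsLocalAlternative P (fun n => Q n g) g := fun g hg => hQ g (Or.inl hg)
  have hQ₁ : ∀ g ∈ G₁, IsLocalAlternative P (fun n => Q n g) g := fun g hg => hQ g (Or.inr hg)
  have hNle : ∀ g₀ ∈ G₀, ∀ g₁ ∈ G₁, N ≤ l2Norm P (g₁ - g₀) := fun g₀ hg₀ g₁ hg₁ =>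
    le_l2Norm_sub hΛ hσpos hr₀ hr₁ hg₀ hg₁
  have hNuniq : ∀ g₀ ∈ G₀, ∀ g₁ ∈ G₁, l2Norm P (g₁ - g₀) ≤ N → g₀ =ᵐ[P] q₀ ∧ g₁ =ᵐ[P] q₁ :=
    fun g₀ hg₀ g₁ hg₁ hle => by
      rw [hq₀, hq₁]; exact ae_eq_of_l2Norm_sub_le hΛ hσpos hr₀ hr₁ hγ hg₀ hg₁ hle
  have hiq₀ : l2Inner P Λ q₀ = r₀ * √8 * σ := by
    rw [hq₀, l2Inner_smul_right, l2Inner_self, ← hσ, ← hγσ]; ring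
  have hiq₁ : l2Inner P Λ q₁ = τ * σ ^ 2 - r₁ * √8 * σ := by
    rw [hq₁, ← sub_smul, l2Inner_smul_right, l2Inner_self, ← hσ, ← hγσ]; ring
  have hi10 : ∀ g, l2Inner P (q₁ - q₀) g = κ * l2Inner P Λ g := fun g => by
    rw [hq10, l2Inner_comm, l2Inner_smul_right, l2Inner_comm]
  -- the pair tests
  have hpair : ∀ g₀ ∈ G₀, ∀ g₁ ∈ G₁, ∀ g ∈ G₀ ∪ G₁, Tendsto (rejectProb Q (pairTest P u g₀ g₁) g)
      atTop (𝓝 (stdNormalCDF (-u + (l2Inner P (g₁ - g₀) g - l2Inner P (g₁ - g₀) g₀)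
        / l2Norm P (g₁ - g₀)))) := fun g₀ hg₀ g₁ hg₁ g hg =>
    tendsto_rejectProb_pairTest (hg.elim (hT₀ g) (hT₁ g)) ((hT₁ g₁ hg₁).sub (hT₀ g₀ hg₀))
      (hgap.trans_le (hNle g₀ hg₀ g₁ hg₁)) (hQ g hg)
  have hlevel : ∀ g₀ ∈ G₀, ∀ g₁ ∈ G₁, asySize Q (pairTest P u g₀ g₁) g₀ = α :=
    fun g₀ hg₀ g₁ hg₁ => by
      have h := (hpair g₀ hg₀ g₁ hg₁ g₀ (Or.inl hg₀)).limsup_eq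
      rwa [sub_self, zero_div, add_zero, hu] at h
  have htest : ∀ g₀ ∈ G₀, ∀ g₁ ∈ G₁, IsTest (pairTest P u g₀ g₁) := fun g₀ hg₀ g₁ hg₁ =>
    isTest_pairTest ((hT₁ g₁ hg₁).sub (hT₀ g₀ hg₀)).measurable
  -- For a general pair only this lower bound is needed; a matching upper bound is required at `q`
  -- alone.
  have hsimple_ge : ∀ g₀ ∈ G₀, ∀ g₁ ∈ G₁,
      stdNormalCDF (-u + l2Norm P (g₁ - g₀)) ≤ simplePower Q α g₀ g₁ := fun g₀ hg₀ g₁ hg₁ => by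
    have h := (hpair g₀ hg₀ g₁ hg₁ g₁ (Or.inr hg₁)).liminf_eq
    have hd := (hT₁ g₁ hg₁).sub (hT₀ g₀ hg₀)
    have hpos := hgap.trans_le (hNle g₀ hg₀ g₁ hg₁)
    rw [← l2Inner_sub_right hd.memLp (hT₁ g₁ hg₁).memLp (hT₀ g₀ hg₀).memLp, l2Inner_self, sq,
      mul_div_cancel_right₀ _ hpos.ne'] at h
    rw [← h]
    refine le_simplePower ⟨htest g₀ hg₀ g₁ hg₁, fun g hg => ?_⟩
    rw [Set.mem_singleton_iff.1 hg, hlevel g₀ hg₀ g₁ hg₁]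
  -- size and power of the optimal test over the two hypotheses
  have hsize : ∀ g₀ ∈ G₀, asySize Q (pairTest P u q₀ q₁) g₀ ≤ α := fun g₀ hg₀ => by
    have h := (hpair q₀ hq₀G q₁ hq₁G g₀ (Or.inl hg₀)).limsup_eq
    rw [asySize, h, ← hu, strictMono_stdNormalCDF.le_iff_le, hNq, hi10, hi10, hiq₀, ← mul_sub]
    have := l2Inner_le_of_mem_null hΛ hr₀ hg₀
    exact add_le_of_nonpos_right (div_nonpos_of_nonpos_of_nonneg
      (mul_nonpos_of_nonneg_of_nonpos hκpos.le (sub_nonpos.2 this)) hgap.le)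
  have hpower_q : asyPower Q (pairTest P u q₀ q₁) q₁ = stdNormalCDF (-u + N) := by
    have h := (hpair q₀ hq₀G q₁ hq₁G q₁ (Or.inr hq₁G)).liminf_eq
    rw [asyPower, h, hNq, hi10, hi10, hiq₀, hiq₁]
    congr 2
    rw [div_eq_iff hgap.ne']
    linear_combination (σ * τ - √8 * (r₀ + r₁)) * hκσ
  have hpower : ∀ g₁ ∈ G₁, stdNormalCDF (-u + N) ≤ asyPower Q (pairTest P u q₀ q₁) g₁ :=
    fun g₁ hg₁ => by
      have h := (hpair q₀ hq₀G q₁ hq₁G g₁ (Or.inr hg₁)).liminf_eq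
      rw [← hpower_q, asyPower, asyPower, h,
        (hpair q₀ hq₀G q₁ hq₁G q₁ (Or.inr hq₁G)).liminf_eq, strictMono_stdNormalCDF.le_iff_le,
        hNq, hi10, hi10, hi10, hiq₁]
      have := le_l2Inner_of_mem_alt hΛ hr₁ hg₁
      gcongr
  -- the explicit form of the optimal test
  set k := σ * (u + √8 * r₀) with hk
  have hform : ∀ n : ℕ, pairTest P u q₀ q₁ n =
      Set.indicator {x : Fin n → Ω | k < scoreSum Λ n x} 1 := fun n => by
    rw [pairTest]
    congr 1
    ext x
    have e1 : scale n * ∑ i, (q₁ - q₀) (x i) = κ * scoreSum Λ n x := by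
      simp only [hq10, Pi.smul_apply, smul_eq_mul, ← Finset.mul_sum, scoreSum]; ring
    have e2 : l2Norm P (q₁ - q₀) * u + l2Inner P (q₁ - q₀) q₀ = κ * k := by
      rw [hNq, hi10, hiq₀, ← hκσ, hk]; ring
    change l2Norm P (q₁ - q₀) * u + l2Inner P (q₁ - q₀) q₀ < scale n * ∑ i, (q₁ - q₀) (x i) ↔ _
    rw [e1, e2]
    exact mul_lt_mul_iff_right₀ hκpos
  -- the asymptotic Neyman–Pearson lemma at the least favorable pair
  have hab : r₀ * γ < τ - r₁ * γ := by linarith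
  have hq₁' : q₁ = (τ - r₁ * γ) • Λ := by rw [hq₁, sub_smul]
  have hL₀ : IsLocalAlternative P (fun n => Q n q₀) ((r₀ * γ) • Λ) := by
    simpa only [← hq₀] using hQ₀ q₀ hq₀G
  have hL₁ : IsLocalAlternative P (fun n => Q n q₁) ((τ - r₁ * γ) • Λ) := by
    simpa only [← hq₁'] using hQ₁ q₁ hq₁G
  -- Under `q₀` the score sum is asymptotically `N(r₀γσ², σ²)`, and `k` is its upper `α`-point.
  have hΦ₀ : stdNormalCDF ((r₀ * γ * l2Norm P Λ ^ 2 - k) / l2Norm P Λ) = α := by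
    rw [← hu, ← hσ]
    congr 1
    rw [div_eq_iff hσpos.ne', hk]
    linear_combination r₀ * σ * hγσ
  have hΦ₁ : (((τ - r₁ * γ) * l2Norm P Λ ^ 2 - k) / l2Norm P Λ) = -u + N := by
    rw [← hσ, div_eq_iff hσpos.ne', hk, hN]
    linear_combination -r₁ * σ * hγσ
  have hNP : ∀ δ, IsLevelTest Q α {q₀} δ → asyPower Q δ q₁ ≤ stdNormalCDF (-u + N) :=
    fun δ hδ => hδ.1.asyPower_le <| by
      rw [← hΦ₁]
      refine eventually_localPower_le hΛ hσpos hab hL₀ hL₁ k hδ.1 ?_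
      rw [hΦ₀]
      exact hδ.1.eventually_rejectProb_le (hδ.2 q₀ rfl)
  have hsub : ∀ δ, IsLevelTest Q α G₀ δ → IsLevelTest Q α {q₀} δ := fun δ hδ =>
    ⟨hδ.1, fun g hg => by rw [Set.mem_singleton_iff.1 hg]; exact hδ.2 q₀ hq₀G⟩
  have hqlevel : IsLevelTest Q α G₀ (pairTest P u q₀ q₁) := ⟨htest q₀ hq₀G q₁ hq₁G, hsize⟩
  have hsimple_q : simplePower Q α q₀ q₁ ≤ stdNormalCDF (-u + N) :=
    csSup_le ⟨_, _, hsub _ hqlevel, rfl⟩ (by rintro _ ⟨δ, hδ, rfl⟩; exact hNP δ hδ)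
  have hminpower : minPower Q G₁ (pairTest P u q₀ q₁) = stdNormalCDF (-u + N) := by
    have : Nonempty G₁ := ⟨⟨q₁, hq₁G⟩⟩
    exact le_antisymm ((minPower_le hqlevel.1 hq₁G).trans hpower_q.le)
      (le_ciInf fun g => hpower g g.2)
  have hmax : ∀ δ, IsLevelTest Q α G₀ δ → minPower Q G₁ δ ≤ stdNormalCDF (-u + N) := fun δ hδ =>
    (minPower_le hδ.1 hq₁G).trans (hNP δ (hsub δ hδ))
  refine ⟨⟨hq₀G, hq₁G, fun g₀ hg₀ g₁ hg₁ => ?_⟩, fun g₀ g₁ hlf => ?_,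
    ⟨hq₀G, hq₁G, fun g₀ hg₀ g₁ hg₁ => hNq.trans_le (hNle g₀ hg₀ g₁ hg₁)⟩, fun g₀ g₁ hmin => ?_,
    ⟨hq₀G, hq₁G, hsub _ hqlevel, fun g₀ hg₀ => ?_, fun δ hδ => ?_, fun g₁ hg₁ => ?_⟩,
    ⟨hqlevel, fun δ hδ => ?_⟩, fun n => ?_, fun δ hδ ε hε => ?_, ?_⟩
  · refine hsimple_q.trans (le_trans ?_ (hsimple_ge g₀ hg₀ g₁ hg₁))
    exact strictMono_stdNormalCDF.monotone (add_le_add_right (hNle g₀ hg₀ g₁ hg₁) _)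
  · refine hNuniq g₀ hlf.1 g₁ hlf.2.1 ?_
    -- A least favorable pair satisfies `Φ(-u + ‖g₁ - g₀‖) ≤ Φ(-u + N)`; strict monotonicity of `Φ`
    -- makes it a pair of minimal distance.
    have h := ((hsimple_ge g₀ hlf.1 g₁ hlf.2.1).trans (hlf.2.2 q₀ hq₀G q₁ hq₁G)).trans hsimple_q
    exact le_of_add_le_add_left (strictMono_stdNormalCDF.le_iff_le.1 h)
  · exact hNuniq g₀ hmin.1 g₁ hmin.2.1 ((hmin.2.2 q₀ hq₀G q₁ hq₁G).trans hNq.le)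
  · rw [hlevel q₀ hq₀G q₁ hq₁G]; exact hsize g₀ hg₀
  · rw [hpower_q]; exact hNP δ hδ
  · rw [hpower_q]; exact hpower g₁ hg₁
  · rw [hminpower]; exact hmax δ hδ
  · rw [hform]
    congr 1
    ext x
    change k < scoreSum Λ n x ↔ u + √8 * r₀ < scale n * σ⁻¹ * ∑ i, Λ (x i)
    rw [mul_right_comm, ← div_eq_mul_inv, lt_div_iff₀ hσpos, mul_comm _ σ]
    rfl
  -- A maxmin solution does at least as well as the pair test, so it attains the Neyman–Pearson
  -- bound of the simple problem at `q`, where optimal tests are asymptotically unique.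
  · have hpow : stdNormalCDF (-u + N) ≤ asyPower Q δ q₁ := by
      rw [← hminpower]
      exact (hδ.2 _ hqlevel).trans (minPower_le hδ.1.1 hq₁G)
    have hlim := tendsto_integral_abs_sub_of_optimal hΛ hσpos hab hL₀ hL₁ k hδ.1.1
      (by rw [hΦ₀]; exact hδ.1.1.eventually_rejectProb_le (hδ.1.2 q₀ hq₀G))
      (by rw [hΦ₁]; exact hδ.1.1.eventually_le_rejectProb hpow)
    have hdm : ∀ n, Measurable fun x => |{x | k < scoreSum Λ n x}.indicator 1 x - δ n x| :=
      fun n => ((measurable_one.indicator (measurableSet_lt_scoreSum hΛ.measurable k n)).sub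
        (hδ.1.1 n).1).abs
    have hd1 : ∀ n x, |({x | k < scoreSum Λ n x}.indicator 1 x - δ n x : ℝ)| ≤ 1 := fun n x => by
      have h1 := (isTest_indicator (measurableSet_lt_scoreSum hΛ.measurable k) n).2 x
      have h2 := (hδ.1.1 n).2 x
      rw [abs_le]
      constructor <;> linarith
    have hreal : Tendsto (fun n : ℕ => (Measure.pi fun _ : Fin n => P).real
        {x | ε ≤ |{x | k < scoreSum Λ n x}.indicator 1 x - δ n x|}) atTop (𝓝 0) := by
      have h0 : Tendsto (fun n => (∫ x, |{x | k < scoreSum Λ n x}.indicator 1 x - δ n x|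
          ∂Measure.pi (fun _ : Fin n => P)) / ε) atTop (𝓝 0) := by
        simpa using hlim.div_const ε
      -- Markov's inequality turns convergence in mean into convergence in probability.
      refine squeeze_zero (fun n => measureReal_nonneg) (fun n => ?_) h0
      rw [le_div_iff₀' hε]
      exact mul_meas_ge_le_integral_of_nonneg (ae_of_all _ fun x => abs_nonneg _)
        (integrable_of_abs_le_one (hdm n) fun x => by rw [abs_abs]; exact hd1 n x) ε
    have h2 := (ENNReal.tendsto_ofReal hreal)
    rw [ENNReal.ofReal_zero] at h2
    refine h2.congr fun n => ?_
    rw [ofReal_measureReal (measure_ne_top _ _)]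
    congr 1
    ext x
    simp only [Set.mem_ofPred_eq]
    rw [hform n, abs_sub_comm]
  · have e : -u + τ * σ - √8 * (r₀ + r₁) = -u + N := by rw [hN]; ring
    rw [e]
    exact ⟨⟨_, hqlevel, hminpower⟩, by rintro _ ⟨δ, hδ, rfl⟩; exact hmax δ hδ⟩
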